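/- Let $n\ge 1$, $\gamma>1$, $\mu\ge 0$, $\lambda+\frac2n\mu\ge 0$ and $\varepsilon>0$. Let $(\rho,v,p)$, with $\rho\ge 0$, $p\ge 0$, be a global in time classical solution on $[0,\infty)\times\mathbb R^n$ of the compressible Navier–Stokes system without heat conduction ($k=0$), $$\partial_t\rho+\operatorname{div}(\rho v)=0,\qquad \partial_t(\rho v)+\operatorname{div}(\rho v\otimes v)+\nabla p=\operatorname{Div}T,$$ $$\partial_t\Big(\tfrac12\rho|v|^2+\rho e\Big)+\operatorname{div}\Big(\big(\tfrac12\rho|v|^2+\rho e+p\big)v\Big)=\operatorname{div}(Tv),\qquad p=(\gamma-1)\rho e,$$ where $T_{ij}=\mu(\partial_iv_j+\partial_jv_i)+\lambda\,(\operatorname{div}v)\,\delta_{ij}$. Classical means that $\rho,v,p$ are continuous on $[0,\infty)\times\mathbb R^n$ and $C^1$ on $(0,\infty)\times\mathbb R^n$, that $v(t,\cdot)\in C^2(\mathbb R^n)$ for each $t>0$, and that the equations hold for all $t>0$; $\rho e$ stands for $p/(\gamma-1)$. Suppose that the solution is of the class $K_{NS_0}$, that is, there are positive functions $M_v,M_{Dv},M_\rho,M_p\in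 C([0,\infty))$ and constants $R_0>0$, $T_0\ge 0$ such that for all $t>T_0$ and all $|x|>R_0$ $$|v(t,x)|\le M_v(t)|x|^{\alpha_v},\quad |Dv(t,x)|\le M_{Dv}(t)|x|^{-n-1},\quad \rho(t,x)\le M_\rho(t)|x|^{-n-2-\varepsilon},\quad p(t,x)\le M_p(t)|x|^{-n-\varepsilon},$$ with $\alpha_v=-n$. Suppose also that the energy does not vanish: the energy density $\frac12\rho|v|^2+\frac{p}{\gamma-1}$ is positive at some point $(t,x)$ with $t>T_0$. Then $\int_0^tM_v(\tau)\,d\tau$ grows at least as $t^{1-\alpha_v}=t^{n+1}$ and $M_\rho(t)$ grows at least as $t^{2+\varepsilon}$ when $t\to\infty$: there are constants $c>0$ and $t_*>0$ such that for all $t\ge t_*$ $$\int_0^tM_v(\tau)\,d\tau\ \ge\ c\,t^{1-\alpha_v}\qquad\text{and}\qquad M_\rho(t)\ \ge\ c\,t^{2+\varepsilon}.$$ -/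

import Mathlib

open Set Filter Asymptotics

namespace CompressibleNS

/-- Physical space `ℝⁿ` with its Euclidean norm. -/
abbrev Space (n : ℕ) : Type := EuclideanSpace ℝ (Fin n)

noncomputable section

variable {n : ℕ}

/-- The partial derivative `∂ᵢ f (x)` of a scalar function on `ℝⁿ`. -/
def pderiv (i : Fin n) (f : Space n → ℝ) (x : Space n) : ℝ :=
  fderiv ℝ f x (EuclideanSpace.single i 1)

/-- The divergence `∑ⱼ ∂ⱼ Fⱼ (x)` of a field given by its components. -/
def divergence (F : Fin n → Space n → ℝ) (x : Space n) : ℝ :=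
  ∑ j, pderiv j (F j) x

/-- The Newtonian stress tensor
`Tᵢⱼ = μ (∂ᵢ uⱼ + ∂ⱼ uᵢ) + lam (div u) δᵢⱼ` of a velocity field `u`. -/
def stress (μ lam : ℝ) (u : Space n → Space n) (i j : Fin n) (x : Space n) : ℝ :=
  μ * (pderiv i (fun y => u y j) x + pderiv j (fun y => u y i) x)
    + lam * divergence (fun l y => u y l) x * (if i = j then 1 else 0)

/-- The energy density `ρ |v|² / 2 + ρ e`, where `ρ e = p / (γ - 1)` by the equation of state
`p = (γ - 1) ρ e`. -/
def energyDensity (γ : ℝ) (ρ : ℝ → Space n → ℝ) (v : ℝ → Space n → Space n)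
    (p : ℝ → Space n → ℝ) (t : ℝ) (x : Space n) : ℝ :=
  ρ t x * ‖v t x‖ ^ 2 / 2 + p t x / (γ - 1)

/-- `(ρ, v, p)` (density, velocity, pressure) is a global in time classical solution of the
compressible Navier-Stokes system of a polytropic fluid without heat conduction. -/
structure IsGlobalClassicalSolution (γ μ lam : ℝ) (ρ : ℝ → Space n → ℝ)
    (v : ℝ → Space n → Space n) (p : ℝ → Space n → ℝ) : Prop where
  continuousOn_density :
    ContinuousOn (fun z : ℝ × Space n => ρ z.1 z.2) (Ici 0 ×ˢ univ)
  continuousOn_velocity :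
    ContinuousOn (fun z : ℝ × Space n => v z.1 z.2) (Ici 0 ×ˢ univ)
  continuousOn_pressure :
    ContinuousOn (fun z : ℝ × Space n => p z.1 z.2) (Ici 0 ×ˢ univ)
  contDiffOn_density :
    ContDiffOn ℝ 1 (fun z : ℝ × Space n => ρ z.1 z.2) (Ioi 0 ×ˢ univ)
  contDiffOn_velocity :
    ContDiffOn ℝ 1 (fun z : ℝ × Space n => v z.1 z.2) (Ioi 0 ×ˢ univ)
  contDiffOn_pressure :
    ContDiffOn ℝ 1 (fun z : ℝ × Space n => p z.1 z.2) (Ioi 0 ×ˢ univ)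
  contDiff_velocity_space : ∀ t, 0 < t → ContDiff ℝ 2 (v t)
  density_nonneg : ∀ t x, 0 ≤ t → 0 ≤ ρ t x
  pressure_nonneg : ∀ t x, 0 ≤ t → 0 ≤ p t x
  /-- `∂ₜ ρ + div (ρ v) = 0` -/
  mass : ∀ t x, 0 < t →
    deriv (fun s => ρ s x) t + divergence (fun j y => ρ t y * v t y j) x = 0
  /-- `∂ₜ (ρ v) + div (ρ v ⊗ v) + ∇ p = Div T` -/
  momentum : ∀ t x, 0 < t → ∀ i : Fin n,
    deriv (fun s => ρ s x * v s x i) t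
        + divergence (fun j y => ρ t y * v t y i * v t y j) x + pderiv i (p t) x
      = divergence (fun j => stress μ lam (v t) i j) x
  /-- `∂ₜ (ρ |v|² / 2 + ρ e) + div ((ρ |v|² / 2 + ρ e + p) v) = div (T v)` -/
  energy : ∀ t x, 0 < t →
    deriv (fun s => energyDensity γ ρ v p s x) t
        + divergence (fun j y => (energyDensity γ ρ v p t y + p t y) * v t y j) x
      = divergence (fun j y => ∑ i, stress μ lam (v t) i j y * v t y i) x

/-- The decay bounds with positive continuous majorants `Mv, MDv, Mρ, Mp` on `[0, ∞)` and
exponents `αv, αDv, αρ, αp`, for all particle positions `x` with `|x| > R₀` at times `t > T`. -/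
structure InDecayClass (ρ : ℝ → Space n → ℝ) (v : ℝ → Space n → Space n)
    (p : ℝ → Space n → ℝ) (Mv MDv Mρ Mp : ℝ → ℝ) (αv αDv αρ αp R₀ T : ℝ) : Prop where
  radius_pos : 0 < R₀
  time_nonneg : 0 ≤ T
  continuousOn_Mv : ContinuousOn Mv (Ici 0)
  continuousOn_MDv : ContinuousOn MDv (Ici 0)
  continuousOn_Mρ : ContinuousOn Mρ (Ici 0)
  continuousOn_Mp : ContinuousOn Mp (Ici 0)
  Mv_pos : ∀ t, 0 ≤ t → 0 < Mv t
  MDv_pos : ∀ t, 0 ≤ t → 0 < MDv t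
  Mρ_pos : ∀ t, 0 ≤ t → 0 < Mρ t
  Mp_pos : ∀ t, 0 ≤ t → 0 < Mp t
  velocity_le : ∀ t x, T < t → R₀ < ‖x‖ → ‖v t x‖ ≤ Mv t * ‖x‖ ^ αv
  gradient_le : ∀ t x, T < t → R₀ < ‖x‖ → ‖fderiv ℝ (v t) x‖ ≤ MDv t * ‖x‖ ^ αDv
  density_le : ∀ t x, T < t → R₀ < ‖x‖ → ρ t x ≤ Mρ t * ‖x‖ ^ αρ
  pressure_le : ∀ t x, T < t → R₀ < ‖x‖ → p t x ≤ Mp t * ‖x‖ ^ αp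

/-- The class `K_{NS₀}`: the velocity, its gradient, the density and the pressure decay with the
exponents `-n`, `-n-1`, `-n-2-ε` and `-n-ε`; nothing is required of the temperature. -/
def InKNS₀ (ε : ℝ) (ρ : ℝ → Space n → ℝ) (v : ℝ → Space n → Space n)
    (p : ℝ → Space n → ℝ) (Mv MDv Mρ Mp : ℝ → ℝ) (R₀ T : ℝ) : Prop :=
  InDecayClass ρ v p Mv MDv Mρ Mp (-(n : ℝ)) (-(n : ℝ) - 1) (-(n : ℝ) - 2 - ε) (-(n : ℝ) - ε) R₀ T

end

end CompressibleNS

namespace CompressibleNS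

noncomputable section

open MeasureTheory Topology

/-! ### Conservation laws tested against compactly supported functions. -/

section Calculus

variable {n : ℕ}

/-! The decay forces conservation of the mass `m = ∫ ρ` and of the energy `E`, while the radial
momentum `V(t) = ∫ ρ v·x` must grow linearly. Testing the momentum equation with `x` gives `V' = ∫
(ρ|v|² + n p) - (2μ + nλ) ∫ div v`. Because `v = O(|x|⁻ⁿ)`, the flux of `v` through a sphere of
radius `R` is `O(1/R)`, so the viscous term disappears and `V' ≥ κ E` with `κ = min(2, n(γ-1))`.
This is `mul_integral_energy_le_integral_density_mul_inner_sub`; it is proved with a cutoff at scale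
`R`, with error terms that vanish as `R → ∞`.

For an upper bound, split `V` at `|x| = r = δ t`. The ball contributes at most `r (m/2 + E)`, which
a small `δ` keeps below half of the linear growth (`exists_linear_radius`), so the exterior carries
at least a multiple of `t`. The velocity bound limits the exterior part to `Mv r^{1-n} m`, whence
`Mv ≥ c tⁿ`, which is then integrated in time. Alternatively, `|v||x| ≤ r|v|²/2 + |x|²/(2r)`: the
first term is again paid by the energy, and the second is at most a multiple of `Mρ r^{-1-ε}` by the
density bound, whence `Mρ ≥ c t^{2+ε}`. -/

theorem contDiff_slice {u : ℝ → Space n → ℝ}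
    (hu : ContDiffOn ℝ 1 (fun z : ℝ × Space n => u z.1 z.2) (Ioi 0 ×ˢ univ)) {t : ℝ}
    (ht : 0 < t) : ContDiff ℝ 1 (u t) := by
  have h : ContDiff ℝ 1 (fun x : Space n => ((t, x) : ℝ × Space n)) := by fun_prop
  rw [← contDiffOn_univ]
  exact hu.comp (t := Ioi 0 ×ˢ univ) h.contDiffOn (fun x _ => mk_mem_prod ht (mem_univ _))

theorem hasDerivAt_slice {u : ℝ → Space n → ℝ}
    (hu : ContDiffOn ℝ 1 (fun z : ℝ × Space n => u z.1 z.2) (Ioi 0 ×ˢ univ)) {t : ℝ}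
    (ht : 0 < t) (x : Space n) :
    HasDerivAt (fun s => u s x)
      (fderiv ℝ (fun z : ℝ × Space n => u z.1 z.2) (t, x) (1, 0)) t := by
  have hopen : IsOpen (Ioi (0 : ℝ) ×ˢ (univ : Set (Space n))) := isOpen_Ioi.prod isOpen_univ
  have h1 : DifferentiableAt ℝ (fun z : ℝ × Space n => u z.1 z.2) (t, x) :=
    (hu.contDiffAt (hopen.mem_nhds (mk_mem_prod (mem_Ioi.2 ht) (mem_univ x)))).differentiableAt one_ne_zero
  have h2 : HasDerivAt (fun s : ℝ => ((s, x) : ℝ × Space n)) (1, 0) t :=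
    (hasDerivAt_id t).prodMk (hasDerivAt_const t x)
  exact h1.hasFDerivAt.comp_hasDerivAt t h2

theorem continuousOn_timeDeriv {u : ℝ → Space n → ℝ}
    (hu : ContDiffOn ℝ 1 (fun z : ℝ × Space n => u z.1 z.2) (Ioi 0 ×ˢ univ)) :
    ContinuousOn (fun z : ℝ × Space n =>
      fderiv ℝ (fun z : ℝ × Space n => u z.1 z.2) z (1, 0)) (Ioi 0 ×ˢ univ) :=
  (hu.continuousOn_fderiv_of_isOpen (isOpen_Ioi.prod isOpen_univ) le_rfl).clm_apply
    continuousOn_const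

theorem continuous_pderiv {f : Space n → ℝ} (hf : ContDiff ℝ 1 f) (i : Fin n) :
    Continuous (pderiv i f) :=
  (hf.continuous_fderiv one_ne_zero).clm_apply continuous_const

theorem contDiff_pderiv {f : Space n → ℝ} (hf : ContDiff ℝ 2 f) (i : Fin n) :
    ContDiff ℝ 1 (pderiv i f) :=
  (hf.fderiv_right (m := 1) le_rfl).clm_apply contDiff_const

theorem hasCompactSupport_pderiv {f : Space n → ℝ} (hf : HasCompactSupport f) (i : Fin n) :
    HasCompactSupport (pderiv i f) :=
  hf.fderiv_apply ℝ _

/-- Differentiation under the integral sign against a compactly supported weight. -/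
theorem hasDerivAt_integral_mul {u : ℝ → Space n → ℝ}
    (hu : ContDiffOn ℝ 1 (fun z : ℝ × Space n => u z.1 z.2) (Ioi 0 ×ˢ univ))
    {φ : Space n → ℝ} (hφ : Continuous φ) (hc : HasCompactSupport φ) {t : ℝ} (ht : 0 < t) :
    HasDerivAt (fun s => ∫ x, u s x * φ x) (∫ x, deriv (fun s => u s x) t * φ x) t := by
  set D : ℝ × Space n → ℝ := fun z =>
    fderiv ℝ (fun z : ℝ × Space n => u z.1 z.2) z (1, 0) with hD
  have hDc : ContinuousOn D (Ioi 0 ×ˢ univ) := continuousOn_timeDeriv hu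
  -- Starting at `t / 2` stays away from time zero, where only continuity is available.
  have hK : IsCompact (Icc (t / 2) (2 * t) ×ˢ tsupport φ) := isCompact_Icc.prod hc
  obtain ⟨C, hC⟩ := hK.exists_bound_of_continuousOn
    (hDc.mono (fun z hz => ⟨lt_of_lt_of_le (half_pos ht) hz.1.1, mem_univ _⟩))
  have hpos : ∀ s ∈ Icc (t / 2) (2 * t), 0 < s := fun s hs => lt_of_lt_of_le (half_pos ht) hs.1
  have hnhds : Icc (t / 2) (2 * t) ∈ 𝓝 t := Icc_mem_nhds (by linarith) (by linarith)
  have hint : ∀ s, 0 < s → Integrable (fun x => u s x * φ x) := fun s hs =>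
    ((contDiff_slice hu hs).continuous.mul hφ).integrable_of_hasCompactSupport hc.mul_left
  have hDt : Continuous (fun x => D (t, x)) := by
    rw [← continuousOn_univ]
    exact hDc.comp (by fun_prop) (fun x _ => ⟨ht, mem_univ _⟩)
  have key := hasDerivAt_integral_of_dominated_loc_of_deriv_le (μ := (volume : Measure (Space n)))
    (F := fun s x => u s x * φ x) (F' := fun s x => D (s, x) * φ x)
    (bound := fun x => C * ‖φ x‖) hnhds
    (by
      filter_upwards [hnhds] with s hs using (hint s (hpos s hs)).aestronglyMeasurable)
    (hint t ht) (hDt.mul hφ).aestronglyMeasurable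
    (by
      refine Eventually.of_forall fun x s hs => ?_
      rw [norm_mul]
      by_cases hx : x ∈ tsupport φ
      · exact mul_le_mul_of_nonneg_right (hC (s, x) ⟨hs, hx⟩) (norm_nonneg _)
      · simp [image_eq_zero_of_notMem_tsupport hx])
    ((hφ.norm.integrable_of_hasCompactSupport hc.norm).const_mul C)
    (Eventually.of_forall fun x s hs => (hasDerivAt_slice hu (hpos s hs) x).mul_const (φ x))
  simpa only [(hasDerivAt_slice hu ht _).deriv] using key.2

theorem integral_divergence_mul {F : Fin n → Space n → ℝ} (hF : ∀ j, ContDiff ℝ 1 (F j))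
    {φ : Space n → ℝ} (hφ : ContDiff ℝ 1 φ) (hc : HasCompactSupport φ) :
    ∫ x, divergence F x * φ x = -∫ x, ∑ j, F j x * pderiv j φ x := by
  have h1 : ∀ j, Integrable (fun x => pderiv j (F j) x * φ x) := fun j =>
    ((continuous_pderiv (hF j) j).mul hφ.continuous).integrable_of_hasCompactSupport hc.mul_left
  have h2 : ∀ j, Integrable (fun x => F j x * pderiv j φ x) := fun j =>
    ((hF j).continuous.mul (continuous_pderiv hφ j)).integrable_of_hasCompactSupport
      (hasCompactSupport_pderiv hc j).mul_left
  have h3 : ∀ j, Integrable (fun x => F j x * φ x) := fun j =>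
    ((hF j).continuous.mul hφ.continuous).integrable_of_hasCompactSupport hc.mul_left
  simp only [divergence, Finset.sum_mul]
  rw [integral_finsetSum _ (fun j _ => h1 j), integral_finsetSum _ (fun j _ => h2 j),
    ← Finset.sum_neg_distrib]
  refine Finset.sum_congr rfl fun j _ => ?_
  have := integral_mul_fderiv_eq_neg_fderiv_mul_of_integrable (h1 j) (h2 j) (h3 j)
    (fun x _ => ((hF j).differentiable one_ne_zero).differentiableAt)
    (fun x _ => (hφ.differentiable one_ne_zero).differentiableAt)
  simp only [pderiv] at this ⊢
  rw [this, neg_neg]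

/-- The weak form of a conservation law `∂ₜ u + div F = 0`. -/
theorem hasDerivAt_integral_of_conservationLaw {u : ℝ → Space n → ℝ}
    (hu : ContDiffOn ℝ 1 (fun z : ℝ × Space n => u z.1 z.2) (Ioi 0 ×ˢ univ))
    {t : ℝ} (ht : 0 < t) {F : Fin n → Space n → ℝ} (hF : ∀ j, ContDiff ℝ 1 (F j))
    (hlaw : ∀ x, deriv (fun s => u s x) t + divergence F x = 0)
    {φ : Space n → ℝ} (hφ : ContDiff ℝ 1 φ) (hc : HasCompactSupport φ) :
    HasDerivAt (fun s => ∫ x, u s x * φ x) (∫ x, ∑ j, F j x * pderiv j φ x) t := by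
  convert hasDerivAt_integral_mul hu hφ.continuous hc ht using 1
  rw [← neg_neg (∫ x, ∑ j, F j x * pderiv j φ x), ← integral_divergence_mul hF hφ hc,
    ← integral_neg]
  refine integral_congr_ae (Eventually.of_forall fun x => ?_)
  simp only
  rw [eq_neg_of_add_eq_zero_left (hlaw x)]
  ring

end Calculus

/-! ### Smooth cutoffs at scale `R`. -/

section Cutoff

/-- A smooth cutoff function equal to one for `‖x‖ ≤ R` and vanishing for `‖x‖ ≥ 2 R`. -/
def cutoff (n : ℕ) (R : ℝ) (x : Space n) : ℝ :=
  (⟨1, 2, one_pos, one_lt_two⟩ : ContDiffBump (0 : Space n)) (R⁻¹ • x)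

variable {n : ℕ}

theorem contDiff_cutoff (R : ℝ) : ContDiff ℝ 1 (cutoff n R) :=
  (ContDiffBump.contDiff _).comp (contDiff_const_smul _)

theorem cutoff_nonneg (R : ℝ) (x : Space n) : 0 ≤ cutoff n R x := ContDiffBump.nonneg _

theorem cutoff_le_one (R : ℝ) (x : Space n) : cutoff n R x ≤ 1 := ContDiffBump.le_one _

theorem cutoff_eq_one {R : ℝ} (hR : 0 < R) {x : Space n} (hx : ‖x‖ ≤ R) : cutoff n R x = 1 := by
  refine ContDiffBump.one_of_mem_closedBall _ ?_
  rw [mem_closedBall_zero_iff, norm_smul, norm_inv, Real.norm_of_nonneg hR.le]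
  simpa [inv_mul_le_iff₀ hR] using hx

theorem cutoff_eq_zero {R : ℝ} (hR : 0 < R) {x : Space n} (hx : 2 * R ≤ ‖x‖) :
    cutoff n R x = 0 := by
  refine ContDiffBump.zero_of_le_dist _ ?_
  rw [dist_zero_right, norm_smul, norm_inv, Real.norm_of_nonneg hR.le, ← div_eq_inv_mul]
  simpa [le_div_iff₀ hR] using hx

theorem hasCompactSupport_cutoff {R : ℝ} (hR : 0 < R) : HasCompactSupport (cutoff n R) := by
  refine HasCompactSupport.intro (isCompact_closedBall (0 : Space n) (2 * R)) fun x hx => ?_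
  refine cutoff_eq_zero hR ?_
  simpa using (not_le.1 (fun h => hx (mem_closedBall_zero_iff.2 h))).le

theorem pderiv_cutoff_eq_zero_of_lt {R : ℝ} (hR : 0 < R) {x : Space n} (hx : ‖x‖ < R)
    (j : Fin n) : pderiv j (cutoff n R) x = 0 := by
  have h : cutoff n R =ᶠ[𝓝 x] fun _ => 1 := by
    filter_upwards [(isOpen_lt continuous_norm continuous_const).mem_nhds hx] with y hy
    exact cutoff_eq_one hR (le_of_lt hy)
  simp [pderiv, h.fderiv_eq]

theorem pderiv_cutoff_eq_zero_of_gt {R : ℝ} (hR : 0 < R) {x : Space n} (hx : 2 * R < ‖x‖)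
    (j : Fin n) : pderiv j (cutoff n R) x = 0 := by
  have h : cutoff n R =ᶠ[𝓝 x] fun _ => 0 := by
    filter_upwards [(isOpen_lt continuous_const continuous_norm).mem_nhds hx] with y hy
    exact cutoff_eq_zero hR (le_of_lt hy)
  simp [pderiv, h.fderiv_eq]

/-- All cutoffs are dilations of one fixed bump, so the chain rule produces the factor `1 / R` with
a constant independent of `R`. -/
theorem exists_abs_pderiv_cutoff_le (n : ℕ) :
    ∃ C, 0 ≤ C ∧ ∀ R, 0 < R → ∀ (j : Fin n) (x : Space n),
      |pderiv j (cutoff n R) x| ≤ C / R := by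
  let f : ContDiffBump (0 : Space n) := ⟨1, 2, one_pos, one_lt_two⟩
  have hf : ContDiff ℝ 1 f := f.contDiff
  obtain ⟨C, hC⟩ := ((hf.continuous_fderiv one_ne_zero).norm).bounded_above_of_compact_support
    (f.hasCompactSupport.fderiv ℝ).norm
  refine ⟨C, (norm_nonneg _).trans (hC 0), fun R hR j x => ?_⟩
  have h1 : HasFDerivAt (cutoff n R)
      ((fderiv ℝ f (R⁻¹ • x)).comp (R⁻¹ • ContinuousLinearMap.id ℝ (Space n))) x := by
    refine HasFDerivAt.comp x (hf.differentiable one_ne_zero _).hasFDerivAt ?_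
    exact (hasFDerivAt_id x).const_smul R⁻¹
  rw [pderiv, h1.fderiv]
  simp only [ContinuousLinearMap.comp_apply, _root_.smul_apply,
    ContinuousLinearMap.id_apply, map_smul, smul_eq_mul, abs_mul, abs_inv, abs_of_pos hR]
  rw [div_eq_inv_mul]
  refine mul_le_mul_of_nonneg_left ?_ (inv_nonneg.2 hR.le)
  have h2 := (fderiv ℝ f (R⁻¹ • x)).le_opNorm (EuclideanSpace.single j 1)
  have h3 := hC (R⁻¹ • x)
  simp only [norm_norm] at h3
  simp only [PiLp.norm_single, norm_one, mul_one, Real.norm_eq_abs] at h2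
  exact h2.trans h3

theorem tendsto_integral_mul_cutoff {g : Space n → ℝ} (hg : Integrable g) :
    Tendsto (fun R => ∫ x, g x * cutoff n R x) atTop (𝓝 (∫ x, g x)) := by
  refine tendsto_integral_filter_of_dominated_convergence (fun x => ‖g x‖) ?_ ?_ hg.norm ?_
  · exact Eventually.of_forall fun R =>
      hg.aestronglyMeasurable.mul (contDiff_cutoff R).continuous.aestronglyMeasurable
  · refine Eventually.of_forall fun R => Eventually.of_forall fun x => ?_
    rw [norm_mul, Real.norm_of_nonneg (cutoff_nonneg R x)]
    exact mul_le_of_le_one_right (norm_nonneg _) (cutoff_le_one R x)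
  · refine Eventually.of_forall fun x => tendsto_const_nhds.congr' ?_
    filter_upwards [eventually_ge_atTop (max 1 ‖x‖)] with R hR
    rw [cutoff_eq_one (lt_of_lt_of_le one_pos ((le_max_left _ _).trans hR))
      ((le_max_right _ _).trans hR), mul_one]

end Cutoff

/-! ### Integrals of functions with power decay. -/

section Decay

variable {n : ℕ}

theorem abs_integral_le_of_annulus {g : Space n → ℝ} {R A : ℝ} (hR : 0 < R)
    (h_in : ∀ x, ‖x‖ < R → g x = 0) (h_out : ∀ x, 2 * R < ‖x‖ → g x = 0)
    (hA : ∀ x, R ≤ ‖x‖ → ‖x‖ ≤ 2 * R → |g x| ≤ A) (hA0 : 0 ≤ A) :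
    |∫ x, g x| ≤ A * (2 ^ n * volume.real (Metric.ball (0 : Space n) 1)) * R ^ n := by
  have h1 : ∫ x, g x = ∫ x in Metric.closedBall (0 : Space n) (2 * R), g x := by
    refine (setIntegral_eq_integral_of_forall_compl_eq_zero fun x hx => h_out x ?_).symm
    simpa using hx
  have h2 := norm_setIntegral_le_of_norm_le_const (μ := (volume : Measure (Space n)))
    (s := Metric.closedBall (0 : Space n) (2 * R)) (f := g) (C := A)
    (measure_closedBall_lt_top) (fun x hx => by
      rw [mem_closedBall_zero_iff] at hx
      by_cases h : ‖x‖ < R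
      · simpa [h_in x h] using hA0
      · exact hA x (not_lt.1 h) hx)
  rw [h1]
  refine h2.trans (le_of_eq ?_)
  rw [Measure.addHaar_real_closedBall _ _ (by positivity)]
  simp only [finrank_euclideanSpace, Fintype.card_fin]
  ring

/-- Outside the ball, `r + ‖x‖ ≤ 2 ‖x‖`. This trades a power singular at the origin for a rescaled
copy of a fixed function on the whole space; `r = 1` serves integrability, and `r` proportional to
`t` serves the tail estimate for the density. -/
theorem rpow_neg_norm_le {r a : ℝ} (hr : 0 < r) (ha : 0 ≤ a) {x : Space n} (hx : r < ‖x‖) :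
    ‖x‖ ^ (-a) ≤ r ^ (-a) * (2 ^ a * (1 + ‖r⁻¹ • x‖) ^ (-a)) := by
  have hx0 : 0 < ‖x‖ := hr.trans hx
  rw [norm_smul, norm_inv, Real.norm_of_nonneg hr.le]
  have h1 : (1 + r⁻¹ * ‖x‖) * r / 2 ≤ ‖x‖ := by
    have : (1 + r⁻¹ * ‖x‖) * r = r + ‖x‖ := by field_simp
    rw [this]; linarith
  have h3 : r ^ (-a) * (2 ^ a * (1 + r⁻¹ * ‖x‖) ^ (-a)) = ((1 + r⁻¹ * ‖x‖) * r / 2) ^ (-a) := by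
    rw [Real.div_rpow (by positivity) (by norm_num), Real.mul_rpow (by positivity) hr.le,
      Real.rpow_neg (by norm_num : (0 : ℝ) ≤ 2), div_inv_eq_mul]
    ring
  rw [h3]
  exact Real.rpow_le_rpow_of_nonpos (by positivity) h1 (by linarith)

theorem integrable_of_decay {g : Space n → ℝ} (hg : Continuous g) {C R a : ℝ}
    (ha : (n : ℝ) < a) (h : ∀ x, R < ‖x‖ → |g x| ≤ C * ‖x‖ ^ (-a)) : Integrable g := by
  have ha0 : 0 ≤ a := (Nat.cast_nonneg n).trans ha.le
  refine hg.locallyIntegrable.integrable_of_isBigO_cocompact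
    (g := fun x : Space n => (1 + ‖x‖) ^ (-a)) ?_
    ((integrable_one_add_norm (by simpa using ha)).integrableAtFilter _)
  refine IsBigO.of_bound (|C| * (2 ^ a)) ?_
  filter_upwards [tendsto_norm_cocompact_atTop.eventually (eventually_gt_atTop (max 1 R))]
    with x hx
  have hx1 : 1 < ‖x‖ := (le_max_left _ _).trans_lt hx
  have h1 := rpow_neg_norm_le one_pos ha0 hx1
  simp only [Real.one_rpow, one_mul, inv_one, one_smul] at h1
  rw [Real.norm_eq_abs, Real.norm_of_nonneg (by positivity), mul_assoc]
  refine (h x ((le_max_right _ _).trans_lt hx)).trans ?_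
  exact mul_le_mul (le_abs_self C) h1 (by positivity) (abs_nonneg _)

end Decay

/-! ### Errors produced by the cutoff. -/

section BoundaryTerms

variable {n : ℕ}

/-- The cutoff gradient has size `1 / R` and lives on an annulus of volume at most a multiple of `R
^ n`; a flux of order `R⁻ⁿ` thus leaks only `O(1/R)`. -/
theorem exists_abs_integral_flux_cutoff_le (n : ℕ) :
    ∃ C, 0 ≤ C ∧ ∀ (F : Fin n → Space n → ℝ) (R A : ℝ), 1 ≤ R → 0 ≤ A →
      (∀ x, R ≤ ‖x‖ → ∀ j, |F j x| ≤ A) →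
      |∫ x, ∑ j, F j x * pderiv j (cutoff n R) x| ≤ C * (A * R ^ n) / R := by
  obtain ⟨C, hC0, hC⟩ := exists_abs_pderiv_cutoff_le n
  refine ⟨n * C * (2 ^ n * volume.real (Metric.ball (0 : Space n) 1)), by positivity,
    fun F R A hR hA hF => ?_⟩
  have hR0 : 0 < R := one_pos.trans_le hR
  have h := abs_integral_le_of_annulus (g := fun x => ∑ j, F j x * pderiv j (cutoff n R) x)
    (A := n * (A * (C / R))) hR0
    (fun x hx => by simp [pderiv_cutoff_eq_zero_of_lt hR0 hx])
    (fun x hx => by simp [pderiv_cutoff_eq_zero_of_gt hR0 hx])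
    (fun x hx _ => by
      refine (Finset.abs_sum_le_sum_abs _ _).trans ?_
      refine (Finset.sum_le_card_nsmul _ _ (A * (C / R)) fun j _ => ?_).trans (by simp)
      rw [abs_mul]
      exact mul_le_mul (hF x hx j) (hC R hR0 j x) (abs_nonneg _) hA)
    (by positivity)
  refine h.trans (le_of_eq ?_)
  ring

/-- Here the weight `|x i| ≤ 2 R` cancels the factor `1 / R`, so the error vanishes only if `F`
decays strictly faster than `R⁻ⁿ`. -/
theorem exists_abs_integral_moment_cutoff_le (n : ℕ) :
    ∃ C, 0 ≤ C ∧ ∀ (F : Fin n → Fin n → Space n → ℝ) (R A : ℝ), 1 ≤ R → 0 ≤ A →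
      (∀ x, R ≤ ‖x‖ → ∀ i j, |F i j x| ≤ A) →
      |∫ x, ∑ i, ∑ j, F i j x * (x i * pderiv j (cutoff n R) x)| ≤ C * (A * R ^ n) := by
  obtain ⟨C, hC0, hC⟩ := exists_abs_pderiv_cutoff_le n
  refine ⟨n * (n * (2 * C)) * (2 ^ n * volume.real (Metric.ball (0 : Space n) 1)), by positivity,
    fun F R A hR hA hF => ?_⟩
  have hR0 : 0 < R := one_pos.trans_le hR
  have h := abs_integral_le_of_annulus
    (g := fun x => ∑ i, ∑ j, F i j x * (x i * pderiv j (cutoff n R) x))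
    (A := n * (n * (A * (2 * C)))) hR0
    (fun x hx => by simp [pderiv_cutoff_eq_zero_of_lt hR0 hx])
    (fun x hx => by simp [pderiv_cutoff_eq_zero_of_gt hR0 hx])
    (fun x hx hx' => by
      refine (Finset.abs_sum_le_sum_abs _ _).trans ?_
      refine (Finset.sum_le_card_nsmul _ _ (n * (A * (2 * C))) fun i _ => ?_).trans (by simp)
      refine (Finset.abs_sum_le_sum_abs _ _).trans ?_
      refine (Finset.sum_le_card_nsmul _ _ (A * (2 * C)) fun j _ => ?_).trans (by simp)
      rw [abs_mul, abs_mul]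
      have h1 : |x i| ≤ 2 * R := (PiLp.norm_apply_le x i).trans hx'
      have h2 : |x i| * |pderiv j (cutoff n R) x| ≤ 2 * R * (C / R) :=
        mul_le_mul h1 (hC R hR0 j x) (abs_nonneg _) (by positivity)
      have h3 : 2 * R * (C / R) = 2 * C := by field_simp
      exact mul_le_mul (hF x hx i j) (h3 ▸ h2) (by positivity) hA)
    (by positivity)
  refine h.trans (le_of_eq ?_)
  ring

/-- The flux estimate bounds the time derivative of the truncated integral, and the mean value
inequality integrates it. The constant is uniform in `t` as well as in `R`. -/
theorem exists_abs_integral_sub_le_of_conservationLaw {u : ℝ → Space n → ℝ}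
    (hu : ContDiffOn ℝ 1 (fun z : ℝ × Space n => u z.1 z.2) (Ioi 0 ×ˢ univ))
    {F : ℝ → Fin n → Space n → ℝ} (hF : ∀ t, 0 < t → ∀ j, ContDiff ℝ 1 (F t j))
    (hlaw : ∀ t, 0 < t → ∀ x, deriv (fun s => u s x) t + divergence (F t) x = 0)
    {t₁ t₂ R₁ K : ℝ} (ht₁ : 0 < t₁) (hR₁ : 1 ≤ R₁) (hK : 0 ≤ K)
    (hdecay : ∀ t ∈ Icc t₁ t₂, ∀ R, R₁ ≤ R → ∀ x, R ≤ ‖x‖ → ∀ j,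
      |F t j x| ≤ K * (R ^ n)⁻¹) :
    ∃ C, 0 ≤ C ∧ ∀ R, R₁ ≤ R → ∀ t ∈ Icc t₁ t₂,
      |(∫ x, u t x * cutoff n R x) - ∫ x, u t₁ x * cutoff n R x| ≤ C / R := by
  obtain ⟨C, hC0, hC⟩ := exists_abs_integral_flux_cutoff_le n
  refine ⟨C * K * |t₂ - t₁|, by positivity, fun R hR t ht => ?_⟩
  have hR1 : 1 ≤ R := hR₁.trans hR
  have hR0 : 0 < R := one_pos.trans_le hR1
  have hmem : t₁ ∈ Icc t₁ t₂ := ⟨le_rfl, ht.1.trans ht.2⟩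
  have h := (convex_Icc t₁ t₂).norm_image_sub_le_of_norm_hasDerivWithin_le
    (f := fun s => ∫ x, u s x * cutoff n R x) (C := C * K / R)
    (fun s hs => (hasDerivAt_integral_of_conservationLaw hu (ht₁.trans_le hs.1)
      (hF s (ht₁.trans_le hs.1)) (hlaw s (ht₁.trans_le hs.1)) (contDiff_cutoff R)
      (hasCompactSupport_cutoff hR0)).hasDerivWithinAt)
    (fun s hs => by
      refine (hC (F s) R (K * (R ^ n)⁻¹) hR1 (by positivity) (hdecay s hs R hR)).trans
        (le_of_eq ?_)
      field_simp) hmem ht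
  refine h.trans ?_
  rw [Real.norm_eq_abs, abs_of_nonneg (sub_nonneg.2 ht.1), div_mul_eq_mul_div]
  gcongr
  exact (sub_le_sub_right ht.2 _).trans (le_abs_self _)

theorem integral_eq_of_abs_integral_cutoff_sub_le {f g : Space n → ℝ} (hf : Integrable f)
    (hg : Integrable g) {C R₁ : ℝ}
    (h : ∀ R, R₁ ≤ R → |(∫ x, f x * cutoff n R x) - ∫ x, g x * cutoff n R x| ≤ C / R) :
    ∫ x, f x = ∫ x, g x := by
  have h1 : Tendsto (fun R => (∫ x, f x * cutoff n R x) - ∫ x, g x * cutoff n R x) atTop (𝓝 0) :=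
    squeeze_zero_norm' ((eventually_ge_atTop R₁).mono h) (tendsto_const_nhds.div_atTop tendsto_id)
  exact sub_eq_zero.1 (tendsto_nhds_unique
    ((tendsto_integral_mul_cutoff hf).sub (tendsto_integral_mul_cutoff hg)) h1)

end BoundaryTerms

/-! ### Divergence form of the momentum and energy equations. -/

section Fluxes

variable {n : ℕ} {γ μ lam : ℝ} {ρ : ℝ → Space n → ℝ} {v : ℝ → Space n → Space n}
  {p : ℝ → Space n → ℝ}

/-- The flux of the momentum component `ρ vᵢ` in the direction `j`. -/
def momentumFlux (μ lam : ℝ) (ρ : Space n → ℝ) (v : Space n → Space n) (p : Space n → ℝ)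
    (i j : Fin n) (x : Space n) : ℝ :=
  ρ x * v x i * v x j + (if i = j then p x else 0) - stress μ lam v i j x

/-- The flux of the energy density `e` in the direction `j`. -/
def energyFlux (μ lam : ℝ) (e : Space n → ℝ) (v : Space n → Space n) (p : Space n → ℝ)
    (j : Fin n) (x : Space n) : ℝ :=
  (e x + p x) * v x j - ∑ i, stress μ lam v i j x * v x i

theorem divergence_add {F G : Fin n → Space n → ℝ} (hF : ∀ j, Differentiable ℝ (F j))
    (hG : ∀ j, Differentiable ℝ (G j)) (x : Space n) :
    divergence (fun j y => F j y + G j y) x = divergence F x + divergence G x := by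
  simp only [divergence, pderiv, ← Finset.sum_add_distrib]
  exact Finset.sum_congr rfl fun j _ => by rw [fderiv_fun_add (hF j x) (hG j x)]; rfl

theorem divergence_sub {F G : Fin n → Space n → ℝ} (hF : ∀ j, Differentiable ℝ (F j))
    (hG : ∀ j, Differentiable ℝ (G j)) (x : Space n) :
    divergence (fun j y => F j y - G j y) x = divergence F x - divergence G x := by
  simp only [divergence, pderiv, ← Finset.sum_sub_distrib]
  exact Finset.sum_congr rfl fun j _ => by rw [fderiv_fun_sub (hF j x) (hG j x)]; rfl

theorem divergence_ite (p : Space n → ℝ) (i : Fin n) (x : Space n) :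
    divergence (fun j y => if i = j then p y else 0) x = pderiv i p x := by
  rw [divergence, Finset.sum_eq_single i]
  · simp
  · intro j _ hj
    simp [pderiv, hj.symm]
  · simp

theorem contDiff_stress {u : Space n → Space n} (hu : ContDiff ℝ 2 u) (i j : Fin n) :
    ContDiff ℝ 1 (stress μ lam u i j) := by
  have h : ∀ k l, ContDiff ℝ 1 (pderiv k (fun y => u y l)) := fun k l =>
    contDiff_pderiv (by fun_prop) k
  unfold stress divergence
  exact (contDiff_const.mul ((h i j).add (h j i))).add
    ((contDiff_const.mul (ContDiff.sum fun l _ => h l l)).mul contDiff_const)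

theorem pderiv_apply {u : Space n → Space n} {x : Space n} (hu : DifferentiableAt ℝ u x)
    (i j : Fin n) :
    pderiv i (fun y => u y j) x = fderiv ℝ u x (EuclideanSpace.single i 1) j := by
  have h := (EuclideanSpace.proj (𝕜 := ℝ) (ι := Fin n) j).hasFDerivAt.comp x hu.hasFDerivAt
  have h' : HasFDerivAt (fun y => u y j)
    ((EuclideanSpace.proj (𝕜 := ℝ) (ι := Fin n) j).comp (fderiv ℝ u x)) x := h
  rw [pderiv, h'.fderiv]
  rfl

theorem abs_pderiv_apply_le {u : Space n → Space n} {x : Space n}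
    (hu : DifferentiableAt ℝ u x) (i j : Fin n) :
    |pderiv i (fun y => u y j) x| ≤ ‖fderiv ℝ u x‖ := by
  rw [pderiv_apply hu]
  refine (PiLp.norm_apply_le (fderiv ℝ u x (EuclideanSpace.single i 1)) j).trans ?_
  simpa using (fderiv ℝ u x).le_opNorm (EuclideanSpace.single i 1)

theorem abs_stress_le {u : Space n → Space n} {x : Space n} (hu : DifferentiableAt ℝ u x)
    (i j : Fin n) :
    |stress μ lam u i j x| ≤ (2 * |μ| + n * |lam|) * ‖fderiv ℝ u x‖ := by
  have h1 := abs_pderiv_apply_le hu i j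
  have h2 := abs_pderiv_apply_le hu j i
  have h3 : |divergence (fun l y => u y l) x| ≤ n * ‖fderiv ℝ u x‖ := by
    refine (Finset.abs_sum_le_sum_abs _ _).trans ?_
    exact (Finset.sum_le_card_nsmul _ _ _ fun l _ => abs_pderiv_apply_le hu l l).trans (by simp)
  have h4 : |(if i = j then (1 : ℝ) else 0)| ≤ 1 := by split_ifs <;> simp
  unfold stress
  refine (abs_add_le _ _).trans ?_
  rw [abs_mul, abs_mul, abs_mul]
  have h5 : |pderiv i (fun y => u y j) x + pderiv j (fun y => u y i) x|
      ≤ ‖fderiv ℝ u x‖ + ‖fderiv ℝ u x‖ := (abs_add_le _ _).trans (add_le_add h1 h2)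
  have h6 := mul_le_mul_of_nonneg_left h5 (abs_nonneg μ)
  have h7 : |lam| * |divergence (fun l y => u y l) x| * |(if i = j then (1 : ℝ) else 0)|
      ≤ |lam| * (n * ‖fderiv ℝ u x‖) * 1 := by gcongr
  linarith

theorem sum_stress_diag (u : Space n → Space n) (x : Space n) :
    ∑ i, stress μ lam u i i x = (2 * μ + n * lam) * divergence (fun l y => u y l) x := by
  simp only [stress, if_true, mul_one, Finset.sum_add_distrib, ← Finset.mul_sum, divergence]
  simp
  ring

/-- This trace is the integrand of the virial identity: testing with the field `x` pairs the flux
with the identity matrix. -/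
theorem sum_momentumFlux_diag (r : Space n → ℝ) (u : Space n → Space n) (q : Space n → ℝ)
    (x : Space n) :
    ∑ i, momentumFlux μ lam r u q i i x =
      r x * ‖u x‖ ^ 2 + n * q x - (2 * μ + n * lam) * divergence (fun l y => u y l) x := by
  simp only [momentumFlux, if_true, Finset.sum_sub_distrib, Finset.sum_add_distrib,
    sum_stress_diag, EuclideanSpace.norm_sq_eq, Finset.mul_sum]
  simp [mul_assoc, sq]

variable (hsol : IsGlobalClassicalSolution γ μ lam ρ v p)
include hsol

namespace IsGlobalClassicalSolution

theorem contDiffOn_momentum (i : Fin n) :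
    ContDiffOn ℝ 1 (fun z : ℝ × Space n => ρ z.1 z.2 * v z.1 z.2 i) (Ioi 0 ×ˢ univ) := by
  have := hsol.contDiffOn_velocity
  exact hsol.contDiffOn_density.mul (by fun_prop)

theorem contDiffOn_energyDensity :
    ContDiffOn ℝ 1 (fun z : ℝ × Space n => energyDensity γ ρ v p z.1 z.2) (Ioi 0 ×ˢ univ) :=
  ((hsol.contDiffOn_density.mul (hsol.contDiffOn_velocity.norm_sq ℝ)).div_const 2).add
    (hsol.contDiffOn_pressure.div_const _)

theorem contDiff_momentumFlux {t : ℝ} (ht : 0 < t) (i j : Fin n) :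
    ContDiff ℝ 1 (momentumFlux μ lam (ρ t) (v t) (p t) i j) := by
  have hρ := contDiff_slice hsol.contDiffOn_density ht
  have hp := contDiff_slice hsol.contDiffOn_pressure ht
  have hv : ContDiff ℝ 1 (v t) := (hsol.contDiff_velocity_space t ht).of_le one_le_two
  refine (ContDiff.add (by fun_prop) ?_).sub
    (contDiff_stress (hsol.contDiff_velocity_space t ht) i j)
  split_ifs
  exacts [hp, contDiff_const]

theorem contDiff_energyFlux {t : ℝ} (ht : 0 < t) (j : Fin n) :
    ContDiff ℝ 1 (energyFlux μ lam (energyDensity γ ρ v p t) (v t) (p t) j) := by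
  have he := contDiff_slice hsol.contDiffOn_energyDensity ht
  have hp := contDiff_slice hsol.contDiffOn_pressure ht
  have hv : ContDiff ℝ 1 (v t) := (hsol.contDiff_velocity_space t ht).of_le one_le_two
  have hT := fun i => contDiff_stress (μ := μ) (lam := lam)
    (hsol.contDiff_velocity_space t ht) i j
  unfold energyFlux
  fun_prop

theorem deriv_momentum_add_divergence {t : ℝ} (ht : 0 < t) (i : Fin n) (x : Space n) :
    deriv (fun s => ρ s x * v s x i) t
      + divergence (momentumFlux μ lam (ρ t) (v t) (p t) i) x = 0 := by
  have hρ := contDiff_slice hsol.contDiffOn_density ht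
  have hp := contDiff_slice hsol.contDiffOn_pressure ht
  have hv : ContDiff ℝ 1 (v t) := (hsol.contDiff_velocity_space t ht).of_le one_le_two
  have h1 : ∀ j, Differentiable ℝ (fun y => ρ t y * v t y i * v t y j) := fun j =>
    ContDiff.differentiable (n := 1) (by fun_prop) one_ne_zero
  have h2 : ∀ j, Differentiable ℝ (fun y => if i = j then p t y else 0) := fun j => by
    split_ifs
    exacts [hp.differentiable one_ne_zero, differentiable_const _]
  have h3 : ∀ j, Differentiable ℝ (stress μ lam (v t) i j) := fun j =>
    (contDiff_stress (hsol.contDiff_velocity_space t ht) i j).differentiable one_ne_zero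
  have h4 : divergence (momentumFlux μ lam (ρ t) (v t) (p t) i) x =
      divergence (fun j y => ρ t y * v t y i * v t y j) x + pderiv i (p t) x
        - divergence (fun j => stress μ lam (v t) i j) x := by
    rw [← divergence_ite (p t) i x, ← divergence_add h1 h2,
      ← divergence_sub (fun j => (h1 j).fun_add (h2 j)) h3]
    rfl
  have := hsol.momentum t x ht i
  rw [h4]
  linarith

theorem deriv_energyDensity_add_divergence {t : ℝ} (ht : 0 < t) (x : Space n) :
    deriv (fun s => energyDensity γ ρ v p s x) t
      + divergence (energyFlux μ lam (energyDensity γ ρ v p t) (v t) (p t)) x = 0 := by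
  have he := contDiff_slice hsol.contDiffOn_energyDensity ht
  have hp := contDiff_slice hsol.contDiffOn_pressure ht
  have hv : ContDiff ℝ 1 (v t) := (hsol.contDiff_velocity_space t ht).of_le one_le_two
  have hT := fun i j => contDiff_stress (μ := μ) (lam := lam)
    (hsol.contDiff_velocity_space t ht) i j
  have h1 : ∀ j, Differentiable ℝ
      (fun y => (energyDensity γ ρ v p t y + p t y) * v t y j) := fun j =>
    ContDiff.differentiable (n := 1) (by fun_prop) one_ne_zero
  have h2 : ∀ j, Differentiable ℝ (fun y => ∑ i, stress μ lam (v t) i j y * v t y i) := fun j =>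
    ContDiff.differentiable (n := 1) (by fun_prop) one_ne_zero
  have h3 := divergence_sub h1 h2 x
  have h4 := hsol.energy t x ht
  have h5 : divergence (energyFlux μ lam (energyDensity γ ρ v p t) (v t) (p t)) x =
      divergence (fun j y => (energyDensity γ ρ v p t y + p t y) * v t y j
        - ∑ i, stress μ lam (v t) i j y * v t y i) x := rfl
  rw [h5, h3]
  linarith

theorem contDiff_massFlux {t : ℝ} (ht : 0 < t) (j : Fin n) :
    ContDiff ℝ 1 (fun y => ρ t y * v t y j) := by
  have hρ := contDiff_slice hsol.contDiffOn_density ht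
  have hv : ContDiff ℝ 1 (v t) := (hsol.contDiff_velocity_space t ht).of_le one_le_two
  fun_prop

end IsGlobalClassicalSolution

end Fluxes

/-! ### Pointwise flux bounds in the far field. -/

section PointwiseFlux

variable {n : ℕ} {γ μ lam : ℝ}

theorem abs_massFlux_le {r : ℝ} {w : Space n} {B q a : ℝ} (hB : 0 ≤ B) (ha1 : a ≤ 1)
    (hr0 : 0 ≤ r) (hr : r ≤ B * a) (hw : ‖w‖ ≤ B * q) (j : Fin n) :
    |r * w j| ≤ B ^ 2 * q := by
  have h1 : |w j| ≤ B * q := (PiLp.norm_apply_le w j).trans hw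
  rw [abs_mul, abs_of_nonneg hr0]
  have hr' : r ≤ B := hr.trans (mul_le_of_le_one_right hB ha1)
  calc r * |w j| ≤ B * (B * q) := mul_le_mul hr' h1 (abs_nonneg _) hB
    _ = B ^ 2 * q := by ring

/-- Every term contains one factor of size `B * a`, namely density, pressure or velocity gradient;
the velocity itself only has to be bounded. -/
theorem abs_momentumFlux_le {r : Space n → ℝ} {u : Space n → Space n} {q : Space n → ℝ}
    {x : Space n} (hu : DifferentiableAt ℝ u x) {B a : ℝ} (hB : 0 ≤ B) (ha : 0 ≤ a)
    (hr0 : 0 ≤ r x) (hr : r x ≤ B * a) (hq0 : 0 ≤ q x) (hq : q x ≤ B * a) (hux : ‖u x‖ ≤ B)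
    (hDu : ‖fderiv ℝ u x‖ ≤ B * a) (i j : Fin n) :
    |momentumFlux μ lam r u q i j x| ≤ (B ^ 3 + B + (2 * |μ| + n * |lam|) * B) * a := by
  have h1 : |u x i| ≤ B := (PiLp.norm_apply_le _ _).trans hux
  have h2 : |u x j| ≤ B := (PiLp.norm_apply_le _ _).trans hux
  have h3 : |r x * u x i * u x j| ≤ B * a * B * B := by
    rw [abs_mul, abs_mul, abs_of_nonneg hr0]
    gcongr
  have h4 : |if i = j then q x else 0| ≤ B * a := by
    split_ifs
    · rwa [abs_of_nonneg hq0]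
    · simpa using mul_nonneg hB ha
  have h5 : |stress μ lam u i j x| ≤ (2 * |μ| + n * |lam|) * (B * a) :=
    (abs_stress_le hu i j).trans (by gcongr)
  unfold momentumFlux
  refine (abs_sub _ _).trans ?_
  have h6 := abs_add_le (r x * u x i * u x j) (if i = j then q x else 0)
  nlinarith

theorem abs_energyFlux_le (hγ : 1 < γ) {r : Space n → ℝ} {u : Space n → Space n} {q : Space n → ℝ}
    {x : Space n} (hu : DifferentiableAt ℝ u x) {B a : ℝ} (hB : 0 ≤ B) (ha : 0 ≤ a)
    (hr0 : 0 ≤ r x) (hr : r x ≤ B * a) (hq0 : 0 ≤ q x) (hq : q x ≤ B * a) (hux : ‖u x‖ ≤ B)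
    (hDu : ‖fderiv ℝ u x‖ ≤ B * a) (j : Fin n) :
    |energyFlux μ lam (fun y => r y * ‖u y‖ ^ 2 / 2 + q y / (γ - 1)) u q j x|
      ≤ ((B ^ 3 / 2 + B / (γ - 1) + B) * B + n * ((2 * |μ| + n * |lam|) * B * B)) * a := by
  have hγ' : 0 < γ - 1 := sub_pos.2 hγ
  have h1 : ∀ i, |u x i| ≤ B := fun i => (PiLp.norm_apply_le _ _).trans hux
  have h2 : |(r x * ‖u x‖ ^ 2 / 2 + q x / (γ - 1) + q x) * u x j|
      ≤ (B * a * B ^ 2 / 2 + B * a / (γ - 1) + B * a) * B := by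
    rw [abs_mul, abs_of_nonneg (by positivity)]
    gcongr
    exact h1 j
  have h3 : |∑ i, stress μ lam u i j x * u x i|
      ≤ n * ((2 * |μ| + n * |lam|) * (B * a) * B) := by
    refine (Finset.abs_sum_le_sum_abs _ _).trans ?_
    refine (Finset.sum_le_card_nsmul _ _ ((2 * |μ| + n * |lam|) * (B * a) * B)
      fun i _ => ?_).trans (by simp)
    rw [abs_mul]
    exact mul_le_mul ((abs_stress_le hu i j).trans (by gcongr)) (h1 i) (abs_nonneg _)
      (by positivity)
  unfold energyFlux
  refine (abs_sub _ _).trans ((add_le_add h2 h3).trans (le_of_eq ?_))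
  ring

end PointwiseFlux

/-! ### Testing with the truncated position field `x χ`. -/

section VirialIdentity

variable {n : ℕ}

theorem pderiv_coord_mul {χ : Space n → ℝ} {x : Space n} (hχ : DifferentiableAt ℝ χ x)
    (i j : Fin n) :
    pderiv j (fun y => y i * χ y) x = (if i = j then χ x else 0) + x i * pderiv j χ x := by
  have h1 : HasFDerivAt (fun y : Space n => y i) (EuclideanSpace.proj (𝕜 := ℝ) i) x :=
    (EuclideanSpace.proj (𝕜 := ℝ) (ι := Fin n) i).hasFDerivAt
  rw [pderiv, (h1.fun_mul hχ.hasFDerivAt).fderiv, pderiv]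
  by_cases h : i = j
  · subst h; simp [add_comm]
  · simp [h]

/-- Since `∂ⱼ(xᵢ χ) = δᵢⱼ χ + xᵢ ∂ⱼχ`, the pairing separates into the trace term and an error
supported where the cutoff varies. -/
theorem sum_integral_mul_pderiv_coord_mul {F : Fin n → Fin n → Space n → ℝ}
    (hF : ∀ i j, Continuous (F i j)) {χ : Space n → ℝ} (hχ : ContDiff ℝ 1 χ)
    (hc : HasCompactSupport χ) :
    ∑ i, ∫ x, ∑ j, F i j x * pderiv j (fun y => y i * χ y) x =
      (∫ x, (∑ i, F i i x) * χ x) + ∫ x, ∑ i, ∑ j, F i j x * (x i * pderiv j χ x) := by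
  have h1 : ∀ i, Integrable fun x => F i i x * χ x := fun i =>
    ((hF i i).mul hχ.continuous).integrable_of_hasCompactSupport hc.mul_left
  have h2 : ∀ i j, Integrable fun x => F i j x * (x i * pderiv j χ x) := fun i j =>
    Continuous.integrable_of_hasCompactSupport
      (by have := continuous_pderiv hχ j; have := hF i j; fun_prop)
      (hasCompactSupport_pderiv hc j).mul_left.mul_left
  simp only [Finset.sum_mul]
  rw [integral_finsetSum _ fun i _ => h1 i,
    integral_finsetSum _ fun i _ => integrable_finsetSum _ fun j _ => h2 i j,
    ← Finset.sum_add_distrib]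
  refine Finset.sum_congr rfl fun i _ => ?_
  rw [← integral_add (h1 i) (integrable_finsetSum _ fun j _ => h2 i j)]
  refine integral_congr_ae (Eventually.of_forall fun x => ?_)
  simp only [pderiv_coord_mul (hχ.differentiable one_ne_zero x), mul_add, Finset.sum_add_distrib]
  simp

end VirialIdentity

/-! ### Conservation of mass and energy, and the virial inequality. -/

section FarField

variable {n : ℕ} {γ μ lam ε R₀ T : ℝ} {ρ : ℝ → Space n → ℝ} {v : ℝ → Space n → Space n}
  {p : ℝ → Space n → ℝ} {Mv MDv Mρ Mp : ℝ → ℝ}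

/-- The factor `(R ^ n)⁻¹` will cancel the volume of the annulus; `R ^ (-δ)` is the surplus that
makes the moment error vanish. -/
theorem rpow_neg_le_inv_pow_mul {R y a δ : ℝ} (hR : 1 ≤ R) (hy : R ≤ y) (hδ : 0 ≤ δ)
    (ha : n + δ ≤ a) : y ^ (-a) ≤ (R ^ n)⁻¹ * R ^ (-δ) := by
  have hR0 : 0 < R := one_pos.trans_le hR
  have hn : (0 : ℝ) ≤ n := n.cast_nonneg
  calc y ^ (-a) ≤ R ^ (-a) := Real.rpow_le_rpow_of_nonpos hR0 hy (by linarith)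
    _ ≤ R ^ (-(n : ℝ) + -δ) := Real.rpow_le_rpow_of_exponent_le hR (by linarith)
    _ = (R ^ n)⁻¹ * R ^ (-δ) := by
      rw [Real.rpow_add hR0, Real.rpow_neg hR0.le, Real.rpow_natCast]

/-- The decay bounds, uniformly on a compact time interval and outside of a large ball. -/
theorem InKNS₀.exists_farField_bounds (hclass : InKNS₀ ε ρ v p Mv MDv Mρ Mp R₀ T) (hε : 0 < ε)
    {t₁ t₂ : ℝ} (ht₁ : T < t₁) :
    ∃ B, 0 ≤ B ∧ ∀ t ∈ Icc t₁ t₂, ∀ R, R₀ + 1 ≤ R → ∀ x, R ≤ ‖x‖ →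
      ‖v t x‖ ≤ B * (R ^ n)⁻¹ ∧ ‖fderiv ℝ (v t) x‖ ≤ B * ((R ^ n)⁻¹ * R ^ (-min 1 ε)) ∧
      ρ t x ≤ B * ((R ^ n)⁻¹ * R ^ (-min 1 ε)) ∧ p t x ≤ B * ((R ^ n)⁻¹ * R ^ (-min 1 ε)) := by
  have hsub : Icc t₁ t₂ ⊆ Ici 0 := fun t ht =>
    hclass.time_nonneg.trans (ht₁.le.trans ht.1)
  obtain ⟨B₁, h₁⟩ := isCompact_Icc.exists_bound_of_continuousOn
    (hclass.continuousOn_Mv.mono hsub)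
  obtain ⟨B₂, h₂⟩ := isCompact_Icc.exists_bound_of_continuousOn
    (hclass.continuousOn_MDv.mono hsub)
  obtain ⟨B₃, h₃⟩ := isCompact_Icc.exists_bound_of_continuousOn
    (hclass.continuousOn_Mρ.mono hsub)
  obtain ⟨B₄, h₄⟩ := isCompact_Icc.exists_bound_of_continuousOn
    (hclass.continuousOn_Mp.mono hsub)
  refine ⟨max 0 (max (max B₁ B₂) (max B₃ B₄)), le_max_left _ _, fun t ht R hR x hx => ?_⟩
  have hTt : T < t := ht₁.trans_le ht.1
  have hR₀ := hclass.radius_pos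
  have hR1 : 1 ≤ R := by linarith
  have hR₀x : R₀ < ‖x‖ := by linarith
  -- Beyond `-n` the gradient has surplus `1`, the density `2 + ε` and the pressure `ε`; the common
  -- surplus is `min 1 ε`, while the velocity has none.
  have hδ : 0 ≤ min 1 ε := le_min zero_le_one hε.le
  have hδ1 : min 1 ε ≤ 1 := min_le_left _ _
  have hδε : min 1 ε ≤ ε := min_le_right _ _
  have key : ∀ {M b B y z : ℝ}, ‖M‖ ≤ b → b ≤ B → 0 ≤ y → y ≤ z → M * y ≤ B * z :=
    fun hM hb hy hyz => mul_le_mul (((le_abs_self _).trans hM).trans hb) hyz hy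
      (((norm_nonneg _).trans hM).trans hb)
  have hnn : ∀ a : ℝ, 0 ≤ ‖x‖ ^ a := fun a => by positivity
  refine ⟨(hclass.velocity_le t x hTt hR₀x).trans (key (h₁ t ht) (by simp) (hnn _) ?_),
    (hclass.gradient_le t x hTt hR₀x).trans (key (h₂ t ht) (by simp) (hnn _) ?_),
    (hclass.density_le t x hTt hR₀x).trans (key (h₃ t ht) (by simp) (hnn _) ?_),
    (hclass.pressure_le t x hTt hR₀x).trans (key (h₄ t ht) (by simp) (hnn _) ?_)⟩
  · simpa using rpow_neg_le_inv_pow_mul (n := n) (a := n) (δ := 0) hR1 hx le_rfl (by simp)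
  · rw [show -(n : ℝ) - 1 = -(n + 1) by ring]
    exact rpow_neg_le_inv_pow_mul hR1 hx hδ (by linarith)
  · rw [show -(n : ℝ) - 2 - ε = -(n + 2 + ε) by ring]
    exact rpow_neg_le_inv_pow_mul hR1 hx hδ (by linarith)
  · rw [show -(n : ℝ) - ε = -(n + ε) by ring]
    exact rpow_neg_le_inv_pow_mul hR1 hx hδ (by linarith)

theorem norm_velocity_le (hclass : InKNS₀ ε ρ v p Mv MDv Mρ Mp R₀ T) {t : ℝ}
    (ht : T < t) {x : Space n} (hx : R₀ < ‖x‖) (hx1 : 1 ≤ ‖x‖) :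
    ‖v t x‖ ≤ Mv t := by
  have ht0 : 0 < t := hclass.time_nonneg.trans_lt ht
  refine (hclass.velocity_le t x ht hx).trans
    (mul_le_of_le_one_right (hclass.Mv_pos t ht0.le).le ?_)
  exact Real.rpow_le_one_of_one_le_of_nonpos hx1 (by simp)

variable (hsol : IsGlobalClassicalSolution γ μ lam ρ v p)
  (hclass : InKNS₀ ε ρ v p Mv MDv Mρ Mp R₀ T)
include hsol hclass

theorem integrable_density (hε : 0 < ε) {t : ℝ} (ht : T < t) : Integrable (ρ t) := by
  have ht0 : 0 < t := hclass.time_nonneg.trans_lt ht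
  refine integrable_of_decay (contDiff_slice hsol.contDiffOn_density ht0).continuous
    (C := Mρ t) (R := R₀) (a := n + 2 + ε) (by linarith) fun x hx => ?_
  rw [abs_of_nonneg (hsol.density_nonneg t x ht0.le)]
  convert hclass.density_le t x ht hx using 3
  ring

theorem integrable_pressure (hε : 0 < ε) {t : ℝ} (ht : T < t) : Integrable (p t) := by
  have ht0 : 0 < t := hclass.time_nonneg.trans_lt ht
  refine integrable_of_decay (contDiff_slice hsol.contDiffOn_pressure ht0).continuous
    (C := Mp t) (R := R₀) (a := n + ε) (by linarith) fun x hx => ?_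
  rw [abs_of_nonneg (hsol.pressure_nonneg t x ht0.le)]
  convert hclass.pressure_le t x ht hx using 3
  ring

theorem integrable_kinetic (hε : 0 < ε) {t : ℝ} (ht : T < t) :
    Integrable (fun x => ρ t x * ‖v t x‖ ^ 2) := by
  have ht0 : 0 < t := hclass.time_nonneg.trans_lt ht
  have hv := hsol.contDiff_velocity_space t ht0
  refine integrable_of_decay
    ((contDiff_slice hsol.contDiffOn_density ht0).continuous.mul (hv.continuous.norm.pow 2))
    (C := Mρ t * Mv t ^ 2) (R := max R₀ 1) (a := n + 2 + ε) (by linarith) fun x hx => ?_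
  have hx1 : R₀ < ‖x‖ := (le_max_left _ _).trans_lt hx
  have hx2 : 1 < ‖x‖ := (le_max_right _ _).trans_lt hx
  have hρ0 := hsol.density_nonneg t x ht0.le
  have h1 := norm_velocity_le hclass ht hx1 hx2.le
  have h2 := hclass.density_le t x ht hx1
  rw [abs_of_nonneg (by positivity), show -((n : ℝ) + 2 + ε) = -(n : ℝ) - 2 - ε by ring]
  have h3 : 0 < Mv t := hclass.Mv_pos t ht0.le
  have h4 : 0 < Mρ t := hclass.Mρ_pos t ht0.le
  calc ρ t x * ‖v t x‖ ^ 2 ≤ (Mρ t * ‖x‖ ^ (-(n : ℝ) - 2 - ε)) * Mv t ^ 2 := by gcongr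
    _ = _ := by ring

theorem integrable_energyDensity (hε : 0 < ε) {t : ℝ} (ht : T < t) :
    Integrable (energyDensity γ ρ v p t) :=
  ((integrable_kinetic hsol hclass hε ht).div_const 2).add
    ((integrable_pressure hsol hclass hε ht).div_const _)

theorem integrable_density_mul_inner (hε : 0 < ε) {t : ℝ} (ht : T < t) :
    Integrable (fun x => ρ t x * inner ℝ (v t x) x) := by
  have ht0 : 0 < t := hclass.time_nonneg.trans_lt ht
  have hv := (hsol.contDiff_velocity_space t ht0).continuous
  refine integrable_of_decay
    ((contDiff_slice hsol.contDiffOn_density ht0).continuous.mul (hv.inner continuous_id))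
    (C := Mρ t * Mv t) (R := max R₀ 1) (a := n + 1 + ε) (by linarith) fun x hx => ?_
  have hx1 : R₀ < ‖x‖ := (le_max_left _ _).trans_lt hx
  have hx2 : 1 < ‖x‖ := (le_max_right _ _).trans_lt hx
  have hx0 : 0 < ‖x‖ := one_pos.trans hx2
  have hρ0 := hsol.density_nonneg t x ht0.le
  have h1 := norm_velocity_le hclass ht hx1 hx2.le
  have h2 := hclass.density_le t x ht hx1
  have h3 : 0 < Mρ t := hclass.Mρ_pos t ht0.le
  rw [abs_mul, abs_of_nonneg hρ0]
  calc ρ t x * |inner ℝ (v t x) x|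
      ≤ (Mρ t * ‖x‖ ^ (-(n : ℝ) - 2 - ε)) * (Mv t * ‖x‖) := by
        refine mul_le_mul h2 ((abs_real_inner_le_norm _ _).trans ?_) (abs_nonneg _) (by positivity)
        gcongr
    _ = Mρ t * Mv t * ‖x‖ ^ (-((n : ℝ) + 1 + ε)) := by
        rw [show -((n : ℝ) + 1 + ε) = (-(n : ℝ) - 2 - ε) + 1 by ring, Real.rpow_add hx0,
          Real.rpow_one]
        ring

theorem integral_density_eq (hε : 0 < ε) {t₁ t₂ : ℝ} (ht₁ : T < t₁) (ht : t₁ ≤ t₂) :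
    ∫ x, ρ t₂ x = ∫ x, ρ t₁ x := by
  have ht₁0 : 0 < t₁ := hclass.time_nonneg.trans_lt ht₁
  obtain ⟨B, hB, h⟩ := hclass.exists_farField_bounds hε ht₁ (t₂ := t₂)
  obtain ⟨C, -, hC⟩ := exists_abs_integral_sub_le_of_conservationLaw hsol.contDiffOn_density
    (fun t ht => hsol.contDiff_massFlux ht) (fun t ht x => hsol.mass t x ht) ht₁0
    (by linarith [hclass.radius_pos] : 1 ≤ R₀ + 1) (sq_nonneg B)
    (fun t ht R hR x hx j => by
      obtain ⟨h1, -, h3, -⟩ := h t ht R hR x hx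
      have hR1 : 1 ≤ R := by linarith [hclass.radius_pos]
      refine abs_massFlux_le hB ?_
        (hsol.density_nonneg t x (ht₁0.le.trans ht.1)) h3 h1 j
      exact mul_le_one₀ (inv_le_one_of_one_le₀ (one_le_pow₀ hR1)) (by positivity)
        (Real.rpow_le_one_of_one_le_of_nonpos hR1
          (neg_nonpos.2 (le_min zero_le_one hε.le))))
  exact integral_eq_of_abs_integral_cutoff_sub_le (integrable_density hsol hclass hε
    (ht₁.trans_le ht)) (integrable_density hsol hclass hε ht₁)
    (fun R hR => hC R hR t₂ ⟨ht, le_rfl⟩)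

/-- Besides energy conservation, this serves the virial inequality, which needs the truncated energy
at finite `R` uniformly over the time interval. -/
theorem exists_abs_integral_energy_cutoff_sub_le (hγ : 1 < γ) (hε : 0 < ε) {t₁ t₂ : ℝ}
    (ht₁ : T < t₁) :
    ∃ C, 0 ≤ C ∧ ∀ R, R₀ + 1 ≤ R → ∀ t ∈ Icc t₁ t₂,
      |(∫ x, energyDensity γ ρ v p t x * cutoff n R x)
        - ∫ x, energyDensity γ ρ v p t₁ x * cutoff n R x| ≤ C / R := by
  have ht₁0 : 0 < t₁ := hclass.time_nonneg.trans_lt ht₁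
  have hγ' : 0 < γ - 1 := sub_pos.2 hγ
  obtain ⟨B, hB, h⟩ := hclass.exists_farField_bounds hε ht₁ (t₂ := t₂)
  refine exists_abs_integral_sub_le_of_conservationLaw hsol.contDiffOn_energyDensity
    (fun t ht => hsol.contDiff_energyFlux ht)
    (fun t ht x => hsol.deriv_energyDensity_add_divergence ht x) ht₁0
    (by linarith [hclass.radius_pos] : 1 ≤ R₀ + 1)
    (K := (B ^ 3 / 2 + B / (γ - 1) + B) * B + n * ((2 * |μ| + n * |lam|) * B * B))
    (by positivity)
    (fun t ht R hR x hx j => ?_)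
  obtain ⟨h1, h2, h3, h4⟩ := h t ht R hR x hx
  have hR1 : 1 ≤ R := by linarith [hclass.radius_pos]
  have ht0 : 0 < t := ht₁0.trans_le ht.1
  have hq1 : (R ^ n)⁻¹ ≤ 1 := inv_le_one_of_one_le₀ (one_le_pow₀ hR1)
  have hw1 : R ^ (-min 1 ε) ≤ 1 := Real.rpow_le_one_of_one_le_of_nonpos hR1
    (neg_nonpos.2 (le_min zero_le_one hε.le))
  refine (abs_energyFlux_le hγ
    ((hsol.contDiff_velocity_space t ht0).differentiable two_ne_zero x) hB
    (by positivity) (hsol.density_nonneg t x ht0.le) h3 (hsol.pressure_nonneg t x ht0.le) h4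
    (h1.trans (mul_le_of_le_one_right hB hq1)) h2 j).trans ?_
  refine mul_le_mul_of_nonneg_left (mul_le_of_le_one_right (by positivity) hw1) (by positivity)

theorem integral_energyDensity_eq (hγ : 1 < γ) (hε : 0 < ε) {t₁ t₂ : ℝ} (ht₁ : T < t₁)
    (ht : t₁ ≤ t₂) :
    ∫ x, energyDensity γ ρ v p t₂ x = ∫ x, energyDensity γ ρ v p t₁ x := by
  obtain ⟨C, -, hC⟩ := exists_abs_integral_energy_cutoff_sub_le hsol hclass hγ hε ht₁ (t₂ := t₂)
  exact integral_eq_of_abs_integral_cutoff_sub_le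
    (integrable_energyDensity hsol hclass hε (ht₁.trans_le ht))
    (integrable_energyDensity hsol hclass hε ht₁)
    (fun R hR => hC R hR t₂ ⟨ht, le_rfl⟩)

/-- Virial inequality: the radial momentum grows at least linearly. -/
theorem mul_integral_energy_le_integral_density_mul_inner_sub (hγ : 1 < γ) (hε : 0 < ε)
    {t₁ t₂ : ℝ} (ht₁ : T < t₁) (ht : t₁ ≤ t₂) :
    min 2 (n * (γ - 1)) * (∫ x, energyDensity γ ρ v p t₁ x) * (t₂ - t₁)
      ≤ (∫ x, ρ t₂ x * inner ℝ (v t₂ x) x) - ∫ x, ρ t₁ x * inner ℝ (v t₁ x) x := by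
  have ht₁0 : 0 < t₁ := hclass.time_nonneg.trans_lt ht₁
  have hγ' : 0 < γ - 1 := sub_pos.2 hγ
  have hR₀ := hclass.radius_pos
  -- The largest constant fitting both parts of the energy: `2` for the kinetic part, `n (γ - 1)`
  -- for the internal part, so that `κ e ≤ ρ|v|² + n p`.
  set κ : ℝ := min 2 (n * (γ - 1)) with hκ
  have hκ0 : 0 ≤ κ := le_min zero_le_two (by positivity)
  obtain ⟨B, hB, h⟩ := hclass.exists_farField_bounds hε ht₁ (t₂ := t₂)
  obtain ⟨C₁, hC₁0, hC₁⟩ := exists_abs_integral_moment_cutoff_le n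
  obtain ⟨C₂, hC₂0, hC₂⟩ := exists_abs_integral_flux_cutoff_le n
  obtain ⟨C₃, hC₃0, hC₃⟩ :=
    exists_abs_integral_energy_cutoff_sub_le hsol hclass hγ hε ht₁ (t₂ := t₂)
  set K : ℝ := B ^ 3 + B + (2 * |μ| + n * |lam|) * B with hK
  have hK0 : 0 ≤ K := by positivity
  -- A lower bound for the derivative of the truncated radial momentum that does not depend on time:
  -- initial energy minus the energy leak, the viscous term and the moment error.
  set G : ℝ → ℝ := fun R => κ * ((∫ x, energyDensity γ ρ v p t₁ x * cutoff n R x) - C₃ / R)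
    - |2 * μ + n * lam| * (C₂ * B / R) - C₁ * K * R ^ (-min 1 ε) with hG
  have hinner : ∀ (t R : ℝ) (x : Space n), ∑ i, ρ t x * v t x i * (x i * cutoff n R x)
      = ρ t x * inner ℝ (v t x) x * cutoff n R x := by
    intro t R x
    rw [PiLp.inner_apply, Finset.mul_sum, Finset.sum_mul]
    refine Finset.sum_congr rfl fun i _ => ?_
    simp only [RCLike.inner_apply, conj_trivial]
    ring
  have hfinite : ∀ R, R₀ + 1 ≤ R → G R * (t₂ - t₁) ≤
      (∫ x, ρ t₂ x * inner ℝ (v t₂ x) x * cutoff n R x)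
        - ∫ x, ρ t₁ x * inner ℝ (v t₁ x) x * cutoff n R x := by
    intro R hR
    have hR1 : 1 ≤ R := by linarith
    have hR0 : 0 < R := by linarith
    set χ := cutoff n R with hχdef
    have hχ : ContDiff ℝ 1 χ := contDiff_cutoff R
    have hχc : HasCompactSupport χ := hasCompactSupport_cutoff hR0
    have hxχ : ∀ i : Fin n, ContDiff ℝ 1 (fun y : Space n => y i * χ y) := fun i => by fun_prop
    have hxχc : ∀ i : Fin n, HasCompactSupport (fun y : Space n => y i * χ y) :=
      fun i => hχc.mul_left
    have hsum : ∀ s, 0 < s → ∫ x, ρ s x * inner ℝ (v s x) x * χ x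
        = ∑ i, ∫ x, ρ s x * v s x i * (x i * χ x) := by
      intro s hs
      rw [← integral_finsetSum]
      · exact integral_congr_ae (Eventually.of_forall fun x => (hinner s R x).symm)
      · intro i _
        exact ((contDiff_slice (u := fun s x => ρ s x * v s x i) (hsol.contDiffOn_momentum i) hs).continuous.mul
          (hxχ i).continuous).integrable_of_hasCompactSupport (hxχc i).mul_left
    set V : ℝ → ℝ := fun s => ∑ i, ∫ x, ρ s x * v s x i * (x i * χ x) with hV
    have hderiv : ∀ s, 0 < s → HasDerivAt V (∑ i, ∫ x, ∑ j,
        momentumFlux μ lam (ρ s) (v s) (p s) i j x * pderiv j (fun y => y i * χ y) x) s := by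
      intro s hs
      refine HasDerivAt.fun_sum fun i _ => ?_
      exact hasDerivAt_integral_of_conservationLaw (hsol.contDiffOn_momentum i) hs
        (hsol.contDiff_momentumFlux hs i) (hsol.deriv_momentum_add_divergence hs i)
        (hxχ i) (hxχc i)
    have hbound : ∀ s ∈ Icc t₁ t₂, G R ≤ ∑ i, ∫ x, ∑ j,
        momentumFlux μ lam (ρ s) (v s) (p s) i j x * pderiv j (fun y => y i * χ y) x := by
      intro s hs
      have hs0 : 0 < s := ht₁0.trans_le hs.1
      have hv2 := hsol.contDiff_velocity_space s hs0
      have hv1 : ContDiff ℝ 1 (v s) := hv2.of_le one_le_two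
      have hvc : Continuous (v s) := hv2.continuous
      have hρc := (contDiff_slice hsol.contDiffOn_density hs0).continuous
      have hpc := (contDiff_slice hsol.contDiffOn_pressure hs0).continuous
      have hec := (contDiff_slice hsol.contDiffOn_energyDensity hs0).continuous
      have hvj : ∀ j : Fin n, ContDiff ℝ 1 (fun y => v s y j) := fun j => by fun_prop
      have hdivc : Continuous (divergence (fun l y => v s y l)) := by
        unfold divergence
        exact continuous_finsetSum _ fun j _ => continuous_pderiv (hvj j) j
      rw [sum_integral_mul_pderiv_coord_mul
        (fun i j => (hsol.contDiff_momentumFlux hs0 i j).continuous) hχ hχc]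
      have e1 : |∫ x, ∑ i, ∑ j, momentumFlux μ lam (ρ s) (v s) (p s) i j x
          * (x i * pderiv j χ x)| ≤ C₁ * K * R ^ (-min 1 ε) := by
        refine (hC₁ _ R (K * ((R ^ n)⁻¹ * R ^ (-min 1 ε))) hR1 (by positivity)
          fun x hx i j => ?_).trans (le_of_eq (by field_simp))
        obtain ⟨h1, h2, h3, h4⟩ := h s hs R hR x hx
        exact abs_momentumFlux_le (hv1.differentiable one_ne_zero x) hB (by positivity)
          (hsol.density_nonneg s x hs0.le) h3 (hsol.pressure_nonneg s x hs0.le) h4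
          (h1.trans (mul_le_of_le_one_right hB (inv_le_one_of_one_le₀ (one_le_pow₀ hR1)))) h2 i j
      -- Integration by parts moves the derivative to the cutoff, so the decay `R⁻ⁿ` of the velocity
      -- makes the viscous contribution `O(1/R)`.
      have e2 : |∫ x, divergence (fun l y => v s y l) x * χ x| ≤ C₂ * B / R := by
        rw [integral_divergence_mul hvj hχ hχc, abs_neg]
        refine (hC₂ _ R (B * (R ^ n)⁻¹) hR1 (by positivity) fun x hx j => ?_).trans
          (le_of_eq (by field_simp))
        exact (PiLp.norm_apply_le _ _).trans (h s hs R hR x hx).1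
      have e3 := (abs_le.1 (hC₃ R hR s hs)).1
      have i1 : Integrable fun x => (ρ s x * ‖v s x‖ ^ 2 + n * p s x) * χ x :=
        Continuous.integrable_of_hasCompactSupport (by have := hχ.continuous; fun_prop)
          hχc.mul_left
      have i2 : Integrable fun x => (2 * μ + n * lam)
          * (divergence (fun l y => v s y l) x * χ x) :=
        ((hdivc.mul hχ.continuous).integrable_of_hasCompactSupport hχc.mul_left).const_mul _
      have i3 : Integrable fun x => energyDensity γ ρ v p s x * χ x :=
        (hec.mul hχ.continuous).integrable_of_hasCompactSupport hχc.mul_left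
      have e4 : ∫ x, (∑ i, momentumFlux μ lam (ρ s) (v s) (p s) i i x) * χ x
          = (∫ x, (ρ s x * ‖v s x‖ ^ 2 + n * p s x) * χ x)
            - (2 * μ + n * lam) * ∫ x, divergence (fun l y => v s y l) x * χ x := by
        rw [← integral_const_mul, ← integral_sub i1 i2]
        refine integral_congr_ae (Eventually.of_forall fun x => ?_)
        simp only [sum_momentumFlux_diag]
        ring
      have e5 : κ * ∫ x, energyDensity γ ρ v p s x * χ x
          ≤ ∫ x, (ρ s x * ‖v s x‖ ^ 2 + n * p s x) * χ x := by
        rw [← integral_const_mul]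
        refine integral_mono (i3.const_mul κ) i1 fun x => ?_
        simp only
        rw [← mul_assoc]
        refine mul_le_mul_of_nonneg_right ?_ (cutoff_nonneg R x)
        have hρ0 := hsol.density_nonneg s x hs0.le
        have hp0 := hsol.pressure_nonneg s x hs0.le
        have a1 : κ * (ρ s x * ‖v s x‖ ^ 2 / 2) ≤ 2 * (ρ s x * ‖v s x‖ ^ 2 / 2) :=
          mul_le_mul_of_nonneg_right (min_le_left _ _) (by positivity)
        have a2 : κ * (p s x / (γ - 1)) ≤ n * (γ - 1) * (p s x / (γ - 1)) :=
          mul_le_mul_of_nonneg_right (min_le_right _ _) (by positivity)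
        have a3 : n * (γ - 1) * (p s x / (γ - 1)) = n * p s x := by field_simp
        rw [energyDensity, mul_add]
        linarith
      have e6 : (2 * μ + n * lam) * ∫ x, divergence (fun l y => v s y l) x * χ x
          ≤ |2 * μ + n * lam| * (C₂ * B / R) := by
        refine (le_abs_self _).trans ?_
        rw [abs_mul]
        gcongr
      have e7 : κ * ((∫ x, energyDensity γ ρ v p t₁ x * χ x) - C₃ / R)
          ≤ κ * ∫ x, energyDensity γ ρ v p s x * χ x :=
        mul_le_mul_of_nonneg_left (by linarith) hκ0
      have e8 := (abs_le.1 e1).1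
      rw [e4]
      simp only [hG]
      linarith
    rw [hsum t₂ (ht₁0.trans_le ht), hsum t₁ ht₁0]
    have hd : ∀ s ∈ Icc t₁ t₂, 0 < s := fun s hs => ht₁0.trans_le hs.1
    exact (convex_Icc t₁ t₂).mul_sub_le_image_sub_of_le_deriv (f := V)
      (fun s hs => (hderiv s (hd s hs)).continuousAt.continuousWithinAt)
      (fun s hs => (hderiv s (hd s (interior_subset hs))).differentiableAt.differentiableWithinAt)
      (fun s hs => by
        rw [(hderiv s (hd s (interior_subset hs))).deriv]
        exact hbound s (interior_subset hs))
      t₁ ⟨le_rfl, ht⟩ t₂ ⟨ht, le_rfl⟩ ht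
  have hlimG : Tendsto (fun R => G R * (t₂ - t₁)) atTop
      (𝓝 ((κ * ((∫ x, energyDensity γ ρ v p t₁ x) - 0) - |2 * μ + n * lam| * 0 - C₁ * K * 0)
        * (t₂ - t₁))) := by
    refine Tendsto.mul_const _ (((((tendsto_integral_mul_cutoff
      (integrable_energyDensity hsol hclass hε ht₁)).sub ?_).const_mul κ).sub
        (Tendsto.const_mul _ ?_)).sub (Tendsto.const_mul _ ?_))
    · exact tendsto_const_nhds.div_atTop tendsto_id
    · exact tendsto_const_nhds.div_atTop tendsto_id
    · exact tendsto_rpow_neg_atTop (lt_min one_pos hε)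
  have hlim := le_of_tendsto_of_tendsto hlimG
    ((tendsto_integral_mul_cutoff
      (integrable_density_mul_inner hsol hclass hε (ht₁.trans_le ht))).sub
      (tendsto_integral_mul_cutoff (integrable_density_mul_inner hsol hclass hε ht₁)))
    ((eventually_ge_atTop (R₀ + 1)).mono hfinite)
  simpa using hlim

end FarField

/-! ### Upper bounds on the radial momentum and growth of the majorants. -/

section Growth

variable {n : ℕ} {γ μ lam ε R₀ T : ℝ} {ρ : ℝ → Space n → ℝ} {v : ℝ → Space n → Space n}
  {p : ℝ → Space n → ℝ} {Mv MDv Mρ Mp : ℝ → ℝ}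

/-- On `[t/2, t]` the integrand is at least `c (t/2)ⁿ` once `t ≥ 2 s₀`, and the earlier part of the
integral is nonnegative. -/
theorem isBigO_rpow_integral_of_le {M : ℝ → ℝ} (hM : ContinuousOn M (Ici 0))
    (hM0 : ∀ t, 0 ≤ t → 0 < M t) {c s₀ : ℝ} (hc : 0 < c) (h : ∀ t, s₀ ≤ t → c * t ^ n ≤ M t) :
    (fun t : ℝ => t ^ (1 - (-(n : ℝ)))) =O[atTop] (fun t : ℝ => ∫ τ in (0 : ℝ)..t, M τ) := by
  refine IsBigO.of_bound (2 ^ (n + 1) / c) ?_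
  filter_upwards [eventually_gt_atTop 0, eventually_ge_atTop (2 * s₀)] with t ht hts
  have hI : ∀ a b, 0 ≤ a → 0 ≤ b → IntervalIntegrable M volume a b := fun a b ha hb =>
    (hM.mono fun x hx => (le_inf ha hb).trans hx.1).intervalIntegrable
  have h1 : 0 ≤ ∫ τ in (0 : ℝ)..(t / 2), M τ :=
    intervalIntegral.integral_nonneg (by positivity) fun u hu => (hM0 u hu.1).le
  have h2 : (t - t / 2) * (c * (t / 2) ^ n) ≤ ∫ τ in (t / 2)..t, M τ := by
    have := intervalIntegral.integral_mono_on (μ := volume) (by linarith : t / 2 ≤ t)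
      (intervalIntegrable_const (c := c * (t / 2) ^ n)) (hI (t / 2) t (by positivity) ht.le)
      (fun u hu => by
        refine le_trans ?_ (h u (by linarith [hu.1]))
        have h3 : t / 2 ≤ u := hu.1
        gcongr)
    rwa [intervalIntegral.integral_const, smul_eq_mul] at this
  have h3 := intervalIntegral.integral_add_adjacent_intervals
    (hI 0 (t / 2) le_rfl (by positivity)) (hI (t / 2) t (by positivity) ht.le)
  have h4 : t ^ (1 - (-(n : ℝ))) = t ^ (n + 1) := by
    rw [← Real.rpow_natCast]
    congr 1
    push_cast
    ring
  rw [h4, Real.norm_of_nonneg (by positivity), Real.norm_of_nonneg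
    (intervalIntegral.integral_nonneg ht.le fun u hu => (hM0 u hu.1).le)]
  have h5 : (t - t / 2) * (c * (t / 2) ^ n) = c / 2 ^ (n + 1) * t ^ (n + 1) := by
    rw [div_pow]
    field_simp
    ring
  have h6 : c / 2 ^ (n + 1) * t ^ (n + 1) ≤ ∫ τ in (0 : ℝ)..t, M τ := by linarith
  calc t ^ (n + 1) = 2 ^ (n + 1) / c * (c / 2 ^ (n + 1) * t ^ (n + 1)) := by field_simp
    _ ≤ _ := mul_le_mul_of_nonneg_left h6 (by positivity)

variable (hsol : IsGlobalClassicalSolution γ μ lam ρ v p)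
include hsol

theorem energyDensity_nonneg (hγ : 1 < γ) {t : ℝ} (ht : 0 ≤ t) (x : Space n) :
    0 ≤ energyDensity γ ρ v p t x := by
  have h1 := hsol.density_nonneg t x ht
  have h2 := hsol.pressure_nonneg t x ht
  have h3 : 0 < γ - 1 := sub_pos.2 hγ
  unfold energyDensity
  positivity

theorem kinetic_le_energyDensity (hγ : 1 < γ) {t : ℝ} (ht : 0 ≤ t) (x : Space n) :
    ρ t x * ‖v t x‖ ^ 2 / 2 ≤ energyDensity γ ρ v p t x :=
  le_add_of_nonneg_right (div_nonneg (hsol.pressure_nonneg t x ht) (sub_pos.2 hγ).le)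

theorem density_mul_inner_le_of_norm_le (hγ : 1 < γ) {t : ℝ} (ht : 0 ≤ t) {r : ℝ}
    {x : Space n} (hx : ‖x‖ ≤ r) :
    ρ t x * inner ℝ (v t x) x ≤ r * (ρ t x / 2 + energyDensity γ ρ v p t x) := by
  have hρ := hsol.density_nonneg t x ht
  have hr : 0 ≤ r := (norm_nonneg x).trans hx
  calc ρ t x * inner ℝ (v t x) x ≤ ρ t x * (((1 + ‖v t x‖ ^ 2) / 2) * r) := by
        refine mul_le_mul_of_nonneg_left ((real_inner_le_norm _ _).trans ?_) hρ
        refine mul_le_mul ?_ hx (norm_nonneg x) (by positivity)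
        nlinarith [sq_nonneg (‖v t x‖ - 1)]
    _ = r * (ρ t x / 2 + ρ t x * ‖v t x‖ ^ 2 / 2) := by ring
    _ ≤ _ := by
        gcongr
        exact kinetic_le_energyDensity hsol hγ ht x

variable (hclass : InKNS₀ ε ρ v p Mv MDv Mρ Mp R₀ T)
include hclass

theorem integral_energyDensity_pos (hγ : 1 < γ) (hε : 0 < ε) {t : ℝ} (ht : T < t) {x : Space n}
    (hx : 0 < energyDensity γ ρ v p t x) : 0 < ∫ y, energyDensity γ ρ v p t y := by
  have ht0 : 0 < t := hclass.time_nonneg.trans_lt ht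
  have hc := (contDiff_slice hsol.contDiffOn_energyDensity ht0).continuous
  rw [integral_pos_iff_support_of_nonneg (energyDensity_nonneg hsol hγ ht0.le)
    (integrable_energyDensity hsol hclass hε ht)]
  exact hc.isOpen_support.measure_pos _ ⟨x, hx.ne'⟩

/-- Inside the ball, `|v| ≤ (1 + |v|²)/2` is paid by mass and energy. Outside, `|v||x| ≤ Mv
|x|^{1-n} ≤ Mv r^{1-n}`, because the exponent `1 - n` is nonpositive. -/
theorem integral_density_mul_inner_le_velocity (hn : 1 ≤ n) (hγ : 1 < γ) (hε : 0 < ε) {t r : ℝ}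
    (ht : T < t) (hr : R₀ < r) :
    ∫ x, ρ t x * inner ℝ (v t x) x ≤
      r * ((∫ x, ρ t x) / 2 + ∫ x, energyDensity γ ρ v p t x)
        + Mv t * (r * (r ^ n)⁻¹) * ∫ x, ρ t x := by
  have ht0 : 0 < t := hclass.time_nonneg.trans_lt ht
  have hr0 : 0 < r := hclass.radius_pos.trans hr
  have hMv := hclass.Mv_pos t ht0.le
  have iρ := integrable_density hsol hclass hε ht
  have ie := integrable_energyDensity hsol hclass hε ht
  have i1 : Integrable fun x => r * (ρ t x / 2 + energyDensity γ ρ v p t x) :=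
    ((iρ.div_const 2).add ie).const_mul r
  have i2 : Integrable fun x => Mv t * (r * (r ^ n)⁻¹) * ρ t x := iρ.const_mul _
  have h := integral_mono (integrable_density_mul_inner hsol hclass hε ht) (i1.add i2)
    fun x => by
      have hρ := hsol.density_nonneg t x ht0.le
      have he := energyDensity_nonneg hsol hγ ht0.le x
      simp only [Pi.add_apply]
      rcases le_or_gt ‖x‖ r with hx | hx
      · exact (density_mul_inner_le_of_norm_le hsol hγ ht0.le hx).trans
          (le_add_of_nonneg_right (by positivity))
      · refine le_trans ?_ (le_add_of_nonneg_left (by positivity))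
        have hx0 : 0 < ‖x‖ := hr0.trans hx
        have hn' : (1 : ℝ) ≤ n := by exact_mod_cast hn
        have h1 : ‖x‖ ^ (-(n : ℝ)) * ‖x‖ ≤ r * (r ^ n)⁻¹ := by
          have e : ∀ y : ℝ, 0 < y → y ^ (-(n : ℝ)) * y = y ^ (-(n : ℝ) + 1) := fun y hy => by
            rw [Real.rpow_add hy, Real.rpow_one]
          rw [mul_comm r, ← Real.rpow_natCast, ← Real.rpow_neg hr0.le, e _ hx0, e _ hr0]
          exact Real.rpow_le_rpow_of_nonpos hr0 hx.le (by linarith)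
        have h2 := hclass.velocity_le t x ht (hr.trans hx)
        calc ρ t x * inner ℝ (v t x) x ≤ ρ t x * (Mv t * ‖x‖ ^ (-(n : ℝ)) * ‖x‖) := by
              refine mul_le_mul_of_nonneg_left ((real_inner_le_norm _ _).trans ?_) hρ
              gcongr
          _ = Mv t * (‖x‖ ^ (-(n : ℝ)) * ‖x‖) * ρ t x := by ring
          _ ≤ _ := by gcongr
  refine h.trans (le_of_eq ?_)
  rw [integral_add' i1 i2, integral_const_mul, integral_const_mul,
    integral_add (iρ.div_const 2) ie, integral_div]

/-- Outside the ball, Young's inequality with weight `r` leaves `ρ|x|²/(2r)`. The density bound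
turns `ρ|x|²` into `Mρ |x|^{-n-ε}`, whose tail integral scales as `r^{-ε}`. -/
theorem integral_density_mul_inner_le_density (hγ : 1 < γ) (hε : 0 < ε) {t r : ℝ}
    (ht : T < t) (hr : R₀ < r) :
    ∫ x, ρ t x * inner ℝ (v t x) x ≤
      r * ((∫ x, ρ t x) / 2 + ∫ x, energyDensity γ ρ v p t x)
        + Mρ t / (2 * r) * r ^ (-ε)
          * (2 ^ (n + ε) * ∫ y : Space n, (1 + ‖y‖) ^ (-(n + ε))) := by
  have ht0 : 0 < t := hclass.time_nonneg.trans_lt ht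
  have hr0 : 0 < r := hclass.radius_pos.trans hr
  have hMρ := hclass.Mρ_pos t ht0.le
  have ha : 0 ≤ (n : ℝ) + ε := by positivity
  have iρ := integrable_density hsol hclass hε ht
  have ie := integrable_energyDensity hsol hclass hε ht
  have i1 : Integrable fun x => r * (ρ t x / 2 + energyDensity γ ρ v p t x) :=
    ((iρ.div_const 2).add ie).const_mul r
  have iJ : Integrable fun y : Space n => (1 + ‖y‖) ^ (-(n + ε)) :=
    integrable_one_add_norm (by simpa using hε)
  have i2 : Integrable fun x : Space n => Mρ t / (2 * r) * r ^ (-(n + ε)) * 2 ^ (n + ε)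
      * (1 + ‖r⁻¹ • x‖) ^ (-(n + ε)) :=
    (iJ.comp_smul (inv_ne_zero hr0.ne')).const_mul _
  have h := integral_mono (integrable_density_mul_inner hsol hclass hε ht) (i1.add i2)
    fun x => by
      have hρ := hsol.density_nonneg t x ht0.le
      have he := energyDensity_nonneg hsol hγ ht0.le x
      simp only [Pi.add_apply]
      rcases le_or_gt ‖x‖ r with hx | hx
      · exact (density_mul_inner_le_of_norm_le hsol hγ ht0.le hx).trans
          (le_add_of_nonneg_right (by positivity))
      · have hx0 : 0 < ‖x‖ := hr0.trans hx
        have h1 : ρ t x * ‖x‖ ^ 2 ≤ Mρ t * ‖x‖ ^ (-(n + ε)) := by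
          calc ρ t x * ‖x‖ ^ 2 ≤ Mρ t * ‖x‖ ^ (-(n : ℝ) - 2 - ε) * ‖x‖ ^ 2 := by
                gcongr
                exact hclass.density_le t x ht (hr.trans hx)
            _ = _ := by
                rw [show -((n : ℝ) + ε) = (-(n : ℝ) - 2 - ε) + (2 : ℕ) by push_cast; ring,
                  Real.rpow_add hx0, Real.rpow_natCast, mul_assoc]
        have h2 := rpow_neg_norm_le hr0 ha hx
        have h3 : ‖v t x‖ * ‖x‖ ≤ r * ‖v t x‖ ^ 2 / 2 + ‖x‖ ^ 2 / (2 * r) := by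
          have : r * ‖v t x‖ ^ 2 / 2 + ‖x‖ ^ 2 / (2 * r) - ‖v t x‖ * ‖x‖
              = (r * ‖v t x‖ - ‖x‖) ^ 2 / (2 * r) := by
            field_simp
            ring
          have h4 : 0 ≤ (r * ‖v t x‖ - ‖x‖) ^ 2 / (2 * r) := by positivity
          linarith
        have h5 := h1.trans (mul_le_mul_of_nonneg_left h2 hMρ.le)
        calc ρ t x * inner ℝ (v t x) x
            ≤ ρ t x * (r * ‖v t x‖ ^ 2 / 2 + ‖x‖ ^ 2 / (2 * r)) :=
              mul_le_mul_of_nonneg_left ((real_inner_le_norm _ _).trans h3) hρ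
          _ = r * (ρ t x * ‖v t x‖ ^ 2 / 2) + (ρ t x * ‖x‖ ^ 2) / (2 * r) := by ring
          _ ≤ r * (ρ t x / 2 + energyDensity γ ρ v p t x)
              + (Mρ t * (r ^ (-(n + ε)) * (2 ^ (n + ε) * (1 + ‖r⁻¹ • x‖) ^ (-(n + ε)))))
                / (2 * r) := by
              refine add_le_add (mul_le_mul_of_nonneg_left ?_ hr0.le)
                (div_le_div_of_nonneg_right h5 (by positivity))
              exact (kinetic_le_energyDensity hsol hγ ht0.le x).trans
                (le_add_of_nonneg_left (by positivity))
          _ = _ := by ring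
  refine h.trans (le_of_eq ?_)
  rw [integral_add' i1 i2, integral_const_mul, integral_const_mul,
    integral_add (iρ.div_const 2) ie, integral_div,
    Measure.integral_comp_inv_smul_of_nonneg volume
      (fun y : Space n => (1 + ‖y‖) ^ (-((n : ℝ) + ε))) hr0.le]
  have h5 : r ^ (-((n : ℝ) + ε)) * r ^ n = r ^ (-ε) := by
    rw [← Real.rpow_natCast, ← Real.rpow_add hr0]
    congr 1
    ring
  rw [← h5]
  simp only [finrank_euclideanSpace, Fintype.card_fin, smul_eq_mul]
  ring

/-- There is a radius proportional to time inside of which only a small part of the radial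
momentum is located. -/
theorem exists_linear_radius (hn : 1 ≤ n) (hγ : 1 < γ) (hε : 0 < ε)
    (hE : ∃ t, T < t ∧ ∃ x, 0 < energyDensity γ ρ v p t x) :
    ∃ m δ L s : ℝ, 0 ≤ m ∧ 0 < δ ∧ 0 < L ∧ ∀ t, s ≤ t → T < t ∧ R₀ < δ * t ∧ ∫ x, ρ t x = m ∧
      L * (δ * t) + δ * t * ((∫ x, ρ t x) / 2 + ∫ x, energyDensity γ ρ v p t x)
        ≤ ∫ x, ρ t x * inner ℝ (v t x) x := by
  obtain ⟨t₀, ht₀, x₀, hx₀⟩ := hE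
  have ht₀0 : 0 < t₀ := hclass.time_nonneg.trans_lt ht₀
  have hEpos := integral_energyDensity_pos hsol hclass hγ hε ht₀ hx₀
  set E := ∫ x, energyDensity γ ρ v p t₀ x with hEdef
  set m := ∫ x, ρ t₀ x with hm
  set V₀ := ∫ x, ρ t₀ x * inner ℝ (v t₀ x) x with hV₀
  have hm0 : 0 ≤ m := integral_nonneg fun x => hsol.density_nonneg t₀ x ht₀0.le
  set κ : ℝ := min 2 (n * (γ - 1)) with hκdef
  have hκ : 0 < κ := by
    have : (0 : ℝ) < n := by exact_mod_cast hn
    exact lt_min two_pos (mul_pos this (sub_pos.2 hγ))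
  set Q := m / 2 + E with hQ
  have hQ0 : 0 < Q := by positivity
  -- Chosen so that `2 Q δ t = κ E t / 2`: one `Q δ t` covers the mass and energy term, the other is
  -- the excess `L δ t` with `L = Q`.
  set δ := κ * E / (4 * Q) with hδ
  have hδ0 : 0 < δ := by positivity
  -- From this time on, `V₀ + κ E (t - t₀) ≥ κ E t / 2`.
  set s₁ := 2 * (κ * E * t₀ - V₀) / (κ * E) with hs₁
  refine ⟨m, δ, Q, max (max t₀ s₁) ((R₀ + 1) / δ), hm0, hδ0, hQ0, fun t ht => ?_⟩
  have h1 : t₀ ≤ t := (le_max_left _ _).trans ((le_max_left _ _).trans ht)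
  have h2 : s₁ ≤ t := (le_max_right _ _).trans ((le_max_left _ _).trans ht)
  have h3 : (R₀ + 1) / δ ≤ t := (le_max_right _ _).trans ht
  rw [div_le_iff₀ hδ0] at h3
  rw [hs₁, div_le_iff₀ (by positivity)] at h2
  refine ⟨ht₀.trans_le h1, by linarith, integral_density_eq hsol hclass hε ht₀ h1, ?_⟩
  have h4 := mul_integral_energy_le_integral_density_mul_inner_sub hsol hclass hγ hε ht₀ h1
  rw [integral_density_eq hsol hclass hε ht₀ h1,
    integral_energyDensity_eq hsol hclass hγ hε ht₀ h1, ← hm, ← hEdef, ← hQ]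
  have h5 : Q * (δ * t) + δ * t * Q = κ * E * t / 2 := by
    rw [hδ]
    field_simp
    ring
  rw [h5]
  linarith

theorem exists_le_Mv (hn : 1 ≤ n) (hγ : 1 < γ) (hε : 0 < ε)
    (hE : ∃ t, T < t ∧ ∃ x, 0 < energyDensity γ ρ v p t x) :
    ∃ c s : ℝ, 0 < c ∧ ∀ t, s ≤ t → c * t ^ n ≤ Mv t := by
  obtain ⟨m, δ, L, s, hm, hδ, hL, h⟩ := exists_linear_radius hsol hclass hn hγ hε hE
  -- Only `m ≥ 0` is recorded, so `m + 1` keeps the denominator positive.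
  refine ⟨L * δ ^ n / (m + 1), s, by positivity, fun t ht => ?_⟩
  obtain ⟨h1, h2, h3, h4⟩ := h t ht
  have ht0 : 0 < t := hclass.time_nonneg.trans_lt h1
  have h5 := integral_density_mul_inner_le_velocity hsol hclass hn hγ hε h1 h2
  have hMv := hclass.Mv_pos t ht0.le
  have h6 : L * (δ * t) ≤ Mv t * (δ * t * ((δ * t) ^ n)⁻¹) * m := by
    rw [← h3]
    linarith
  have hr : 0 < δ * t := mul_pos hδ ht0
  have h7 : L * (δ * t) ^ n ≤ Mv t * m := by
    have := mul_le_mul_of_nonneg_right h6 (by positivity : 0 ≤ (δ * t) ^ n / (δ * t))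
    calc L * (δ * t) ^ n = L * (δ * t) * ((δ * t) ^ n / (δ * t)) := by field_simp
      _ ≤ _ := this
      _ = Mv t * m := by field_simp
  rw [div_mul_eq_mul_div, div_le_iff₀ (by positivity), mul_assoc, ← mul_pow]
  nlinarith

theorem isBigO_rpow_Mρ (hn : 1 ≤ n) (hγ : 1 < γ) (hε : 0 < ε)
    (hE : ∃ t, T < t ∧ ∃ x, 0 < energyDensity γ ρ v p t x) :
    (fun t : ℝ => t ^ (2 + ε)) =O[atTop] Mρ := by
  obtain ⟨m, δ, L, s, hm, hδ, hL, h⟩ := exists_linear_radius hsol hclass hn hγ hε hE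
  set J : ℝ := 2 ^ (n + ε) * ∫ y : Space n, (1 + ‖y‖) ^ (-(n + ε)) with hJ
  refine IsBigO.of_bound (J / (2 * L * δ ^ (2 + ε))) ?_
  filter_upwards [eventually_ge_atTop s] with t ht
  obtain ⟨h1, h2, -, h4⟩ := h t ht
  have ht0 : 0 < t := hclass.time_nonneg.trans_lt h1
  have hr : 0 < δ * t := mul_pos hδ ht0
  have h5 := integral_density_mul_inner_le_density hsol hclass hγ hε h1 h2
  rw [← hJ] at h5
  have h6 : L * (δ * t) ≤ Mρ t / (2 * (δ * t)) * (δ * t) ^ (-ε) * J := by linarith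
  have h7 : 2 * L * (δ * t) ^ (2 + ε) ≤ Mρ t * J := by
    -- With `r = δ t`, `h6` reads `L r ≤ Mρ r^{-1-ε} J / 2`; multiplying by `2 r^{1+ε}` isolates
    -- `Mρ`.
    have h8 := mul_le_mul_of_nonneg_right h6
      (by positivity : 0 ≤ 2 * (δ * t) * (δ * t) ^ ε)
    have h9 : (δ * t) ^ (-ε) * (δ * t) ^ ε = 1 := by
      rw [← Real.rpow_add hr, neg_add_cancel, Real.rpow_zero]
    have h10 : (δ * t) ^ (2 + ε) = (δ * t) ^ 2 * (δ * t) ^ ε := by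
      rw [Real.rpow_add hr, Real.rpow_two]
    calc 2 * L * (δ * t) ^ (2 + ε) = L * (δ * t) * (2 * (δ * t) * (δ * t) ^ ε) := by
          rw [h10]; ring
      _ ≤ _ := h8
      _ = Mρ t * J * ((δ * t) ^ (-ε) * (δ * t) ^ ε) := by field_simp
      _ = Mρ t * J := by rw [h9, mul_one]
  rw [Real.norm_of_nonneg (by positivity), Real.norm_of_nonneg (hclass.Mρ_pos t ht0.le).le,
    div_mul_eq_mul_div, le_div_iff₀ (by positivity)]
  rw [Real.mul_rpow hδ.le ht0.le] at h7
  linarith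

end Growth

end

end CompressibleNS

theorem theorem1 (n : ℕ) (hn : 1 ≤ n) (γ μ lam ε : ℝ) (hγ : 1 < γ) (hμ : 0 ≤ μ)
    (hlam : 0 ≤ lam + 2 / (n : ℝ) * μ) (hε : 0 < ε)
    (ρ : ℝ → CompressibleNS.Space n → ℝ)
    (v : ℝ → CompressibleNS.Space n → CompressibleNS.Space n)
    (p : ℝ → CompressibleNS.Space n → ℝ)
    (hsol : CompressibleNS.IsGlobalClassicalSolution γ μ lam ρ v p)
    (Mv MDv Mρ Mp : ℝ → ℝ) (R₀ T : ℝ)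
    (hclass : CompressibleNS.InKNS₀ ε ρ v p Mv MDv Mρ Mp R₀ T)
    (hE : ∃ t, T < t ∧ ∃ x, 0 < CompressibleNS.energyDensity γ ρ v p t x) :
    ((fun t : ℝ => t ^ (1 - (-(n : ℝ)))) =O[atTop] (fun t : ℝ => ∫ τ in (0 : ℝ)..t, Mv τ)) ∧
      ((fun t : ℝ => t ^ (2 + ε)) =O[atTop] Mρ) := by

  obtain ⟨c, s, hc, h⟩ := CompressibleNS.exists_le_Mv hsol hclass hn hγ hε hE
  exact ⟨CompressibleNS.isBigO_rpow_integral_of_le hclass.continuousOn_Mv hclass.Mv_pos hc h,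
    CompressibleNS.isBigO_rpow_Mρ hsol hclass hn hγ hε hE⟩
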